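/- Let $(X,d)$ be a compact metric space with a Borel probability measure $\mu$. Write $B(x,r)=\{y: d(x,y)<r\}$. Assume that $\mu$ is $\delta$-regular, $\delta>0$: there are $r_0>0$ and $0<a<1<b$ such that for all $x\in X$ and $0<r<r'\le r_0$, $$a r^\delta\le \mu(B(x,r))\le b r^\delta\quad\text{and}\quad \mu\big(B(x,r')\setminus B(x,r)\big)\ge a(r'-r)^\delta .$$ Let $u=(u_n)_{n\ge 0}$ be a sequence of positive reals with $\limsup_{n\to\infty} u_n/u_{n+1}<\infty$. Let $Q\subset X$ be countable and let $R:Q\to(0,\infty)$, $\xi\mapsto R_\xi$, be such that $\{\xi\in Q: R_\xi\ge M\}$ is finite for every $M>0$. Put $J_u(n)=\{\xi\in Q: u_n\le R_\xi<u_{n-1}\}$ for $n\ge1$. Let $\rho:(0,\infty)\to(0,\infty)$ be non-decreasing with $\lim_{x\to0^+}\rho(x)=0$, and suppose that $(Q,R)$ is well-distributed relative to $(\rho,u)$, i.e. there are constants $0<c,\kappa<1$ such that * (well-separated) $d(\xi,\zeta)\ge c\min\{R_\xi,R_\zeta\}$ for all distinct $\xi,\zeta\in Q$; * (locally ubiquitous)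 for every ball $B$ of radius at most $r_0$ there is $n_B\ge 1$ such that for all $n\ge n_B$ $$\mu\Big(\bigcup_{\xi\in J_u(n)}B(\xi,\rho(u_{n-1}))\cap B\Big)\ge\kappa\,\mu(B).$$ Suppose that $\rho$ is $u$-regular: there are $n_0$ and $0<\lambda_1<\lambda_2<1$ such that for all $n\ge n_0$, $\lambda_1\rho(u_n)\le\rho(u_{n+1})\le\lambda_2\rho(u_n)$, and $\rho(x)\le x$ for all $0<x\le u_n$. Let $\phi:(0,\infty)\to(0,\infty)$ be non-decreasing with $\lim_{x\to0^+}\phi(x)/x=0$, $\sum_{\xi\in Q}(\phi(R_\xi)/R_\xi)^\delta<\infty$ and $\lim_{n\to\infty}\phi(u_n)/\rho(u_n)=0$. Let $W(Q,R,\phi)$ be the set of $x\in X$ such that $d(x,\xi)<\phi(R_\xi)$ for infinitely many $\xi\in Q$, and let $$E(Q,R,\phi)=W(Q,R,\phi)\setminus\bigcup_{0<\epsilon<1}W(Q,R,(1-\epsilon)\phi).$$ Let $s\in(0,\delta)$ and put $g(x)=\phi(x)^s/\rho(x)^\delta$ and $G=\limsup_{n\to\infty}g(u_n)\in[0,\infty]$.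 Then the $s$-dimensional Hausdorff measure satisfies: * if $G=0$ and $\sum_{n=1}^\infty g(u_n)=\infty$, then $\mathcal H^s(E(Q,R,\phi))=\infty$; * if $0<G\le\infty$, then $\mathcal H^s(E(Q,R,\phi))=\infty$. -/

import Mathlib

open Set Filter Topology MeasureTheory
open scoped ENNReal

noncomputable section

namespace ExactApprox

/-- The annulus `A(x, r, R) = B(x, R) \ B(x, r)`, where balls are open. -/
def annulus {X : Type*} [MetricSpace X] (x : X) (r R : ℝ) : Set X :=
  Metric.ball x R \ Metric.ball x r

/-- `μ` is `δ`-regular at all scales up to `r₀`: Ahlfors regularity of balls together with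
the lower bound for the measure of annuli. -/
def IsRegularMeasure {X : Type*} [MetricSpace X] [MeasurableSpace X]
    (μ : Measure X) (δ r₀ : ℝ) : Prop :=
  0 < δ ∧ 0 < r₀ ∧ ∃ a b : ℝ, 0 < a ∧ a < 1 ∧ 1 < b ∧
    ∀ (x : X) (r R : ℝ), 0 < r → r < R → R ≤ r₀ →
      ENNReal.ofReal (a * r ^ δ) ≤ μ (Metric.ball x r) ∧
      μ (Metric.ball x r) ≤ ENNReal.ofReal (b * r ^ δ) ∧
      ENNReal.ofReal (a * (R - r) ^ δ) ≤ μ (annulus x r R)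

/-- `(Q, R)` is a system in `X`: `Q` is countable, the weights `R ξ` of the points `ξ ∈ Q` are
positive, and only finitely many weights exceed a given positive level. The values of `R`
outside `Q` play no role. -/
structure IsSystem {X : Type*} (Q : Set X) (R : X → ℝ) : Prop where
  countable : Q.Countable
  pos : ∀ ξ ∈ Q, 0 < R ξ
  finite : ∀ M : ℝ, 0 < M → {ξ ∈ Q | M ≤ R ξ}.Finite

/-- The set `W(Q, R, φ)` of points `x` with `d(x, ξ) < φ(R ξ)` for infinitely many `ξ ∈ Q`. -/
def wellApprox {X : Type*} [MetricSpace X] (Q : Set X) (R : X → ℝ) (φ : ℝ → ℝ) : Set X :=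
  {x | {ξ ∈ Q | dist x ξ < φ (R ξ)}.Infinite}

/-- The exact set `E(Q, R, φ) = W(Q, R, φ) \ ⋃_{0 < ε < 1} W(Q, R, (1 - ε) φ)`. -/
def exactSet {X : Type*} [MetricSpace X] (Q : Set X) (R : X → ℝ) (φ : ℝ → ℝ) : Set X :=
  wellApprox Q R φ \ ⋃ ε ∈ Ioo (0 : ℝ) 1, wellApprox Q R (fun x => (1 - ε) * φ x)

/-- `f` restricts to a non-decreasing function from `(0, ∞)` to `(0, ∞)`. -/
def IsPosMono (f : ℝ → ℝ) : Prop :=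
  (∀ x, 0 < x → 0 < f x) ∧ ∀ x y, 0 < x → x ≤ y → f x ≤ f y

/-- The layer `J_u(n) = {ξ ∈ Q : u_n ≤ R ξ < u_{n-1}}`; it is meant for `n ≥ 1`. -/
def layer {X : Type*} (Q : Set X) (R : X → ℝ) (u : ℕ → ℝ) (n : ℕ) : Set X :=
  {ξ ∈ Q | u n ≤ R ξ ∧ R ξ < u (n - 1)}

/-- Distinct points of `Q` satisfy `d(ξ, ζ) ≥ c min(R ξ, R ζ)`. -/
def WellSeparated {X : Type*} [MetricSpace X] (Q : Set X) (R : X → ℝ) (c : ℝ) : Prop :=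
  ∀ ξ ∈ Q, ∀ ζ ∈ Q, ξ ≠ ζ → c * min (R ξ) (R ζ) ≤ dist ξ ζ

/-- Local ubiquity with constant `κ`, for all balls of radius at most `r₀`. -/
def LocallyUbiquitous {X : Type*} [MetricSpace X] [MeasurableSpace X] (μ : Measure X)
    (r₀ : ℝ) (Q : Set X) (R : X → ℝ) (ρ : ℝ → ℝ) (u : ℕ → ℝ) (κ : ℝ) : Prop :=
  ∀ (x : X) (r : ℝ), 0 < r → r ≤ r₀ → ∃ N : ℕ, 1 ≤ N ∧ ∀ n ≥ N,
    ENNReal.ofReal κ * μ (Metric.ball x r) ≤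
      μ ((⋃ ξ ∈ layer Q R u n, Metric.ball ξ (ρ (u (n - 1)))) ∩ Metric.ball x r)

/-- `(Q, R)` is well-distributed in `X` relative to `(ρ, u)`. -/
def WellDistributed {X : Type*} [MetricSpace X] [MeasurableSpace X] (μ : Measure X)
    (r₀ : ℝ) (Q : Set X) (R : X → ℝ) (ρ : ℝ → ℝ) (u : ℕ → ℝ) : Prop :=
  IsPosMono ρ ∧ Tendsto ρ (𝓝[>] 0) (𝓝 0) ∧
    ∃ c κ : ℝ, 0 < c ∧ c < 1 ∧ 0 < κ ∧ κ < 1 ∧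
      WellSeparated Q R c ∧ LocallyUbiquitous μ r₀ Q R ρ u κ

/-- The function `h` on the positive reals is `u`-regular. -/
def IsSeqRegular (h : ℝ → ℝ) (u : ℕ → ℝ) : Prop :=
  ∃ (n₀ : ℕ) (l₁ l₂ : ℝ), 0 < l₁ ∧ l₁ < l₂ ∧ l₂ < 1 ∧ ∀ n ≥ n₀,
    l₁ * h (u n) ≤ h (u (n + 1)) ∧ h (u (n + 1)) ≤ l₂ * h (u n) ∧
    ∀ x, 0 < x → x ≤ u n → h x ≤ x

/-- The function `g = φ ^ s / ρ ^ δ`, as an extended non-negative real. -/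
def gFun (φ ρ : ℝ → ℝ) (s δ x : ℝ) : ℝ≥0∞ :=
  ENNReal.ofReal (φ x ^ s / ρ x ^ δ)

/-- `G = limsup g(u_n)`. -/
def GConst (φ ρ : ℝ → ℝ) (s δ : ℝ) (u : ℕ → ℝ) : ℝ≥0∞ :=
  limsup (fun n => gFun φ ρ s δ (u n)) atTop

end ExactApprox

end

/-! Suppose the exact set had finite `s`-measure. Then it has countable covers by sets `V i` of size
`t i`, arbitrarily fine, with `∑ t i ^ s ≤ B` for one fixed `B`. As `s < δ`, a fine enough cover has
`∑ t i ^ δ` tiny compared with `r ^ δ` for a fixed ball of radius `r`. A point of the exact set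
outside every `V i` is then found as the limit of nested balls, with no measure constructed on a
Cantor set.

The property handed down (`IsNode`) is that the `V i` meeting the current ball have small total `t i
^ δ` relative to its radius, and so do the balls `B(ζ, φ (R ζ))` of weight below a threshold `T`. To
descend, ubiquity and divergence supply separated balls of radius `τ` about points `ξ ∈ Q`, with `τ
^ δ = min (φ ^ s) (ρ ^ δ)`, filling a fixed proportion of the ball (`exists_block`,
`exists_separated_family`). By pigeonhole one of them meets only `V i` with `∑ t i ^ s` small
relative to `τ ^ δ ≤ φ ^ s` (`exists_sparsely_covered`). So one may shrink to a ball of radius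
comparable to `φ (R ξ)` in a thin annulus about `ξ`. There the `s`-sum is small on the new scale,
hence each `t i` is at most the new radius, hence the `δ`-sum is small too (`exists_child`). This
exchange of `φ ^ s` for a `δ`-dimensional volume is the mass transference step.

Exactness requires that between consecutive thresholds no other `ζ` comes within `φ (R ζ)` of the
new ball. Heavy `ζ` are removed beforehand at small cost in measure (`exists_removed_le`); those of
weight comparable to `R ξ` or somewhat lighter are kept away by separation; still lighter ones fall
below the next threshold. -/

namespace ExactApprox

/-- Two-sided power bounds, in terms of real-valued measures, for balls of radius below `r₀`. -/
structure BallBounds {X : Type*} [MetricSpace X] [MeasurableSpace X]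
    (μ : Measure X) (δ r₀ a b : ℝ) : Prop where
  a_pos : 0 < a
  b_pos : 0 < b
  exp_pos : 0 < δ
  le_ball : ∀ (x : X) (r : ℝ), 0 < r → r < r₀ → a * r ^ δ ≤ μ.real (Metric.ball x r)
  ball_le : ∀ (x : X) (r : ℝ), 0 < r → r < r₀ → μ.real (Metric.ball x r) ≤ b * r ^ δ

/-! ### Volume and packing estimates in a regular space -/

section Geometry

variable {X : Type*} [MetricSpace X] [MeasurableSpace X] {μ : Measure X} {δ r₀ a b : ℝ}

/-- The larger of `p τ` and `q` dominates, so `(p τ + q) ^ δ ≤ (2 p τ) ^ δ + (2 q) ^ δ`, whether `δ`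
is above or below `1`. -/
lemma BallBounds.measureReal_biUnion_le (hB : BallBounds μ δ r₀ a b) (S : Finset X) (τ : X → ℝ)
    (p q : ℝ) (hp : 0 ≤ p) (hq : 0 < q) (hτ : ∀ ξ ∈ S, 0 ≤ τ ξ) (hr : ∀ ξ ∈ S, p * τ ξ + q < r₀) :
    μ.real (⋃ ξ ∈ S, Metric.ball ξ (p * τ ξ + q)) ≤
      b * (2 * p) ^ δ * ∑ ξ ∈ S, τ ξ ^ δ + b * 2 ^ δ * (S.card * q ^ δ) := by
  have hδ := hB.exp_pos
  calc μ.real (⋃ ξ ∈ S, Metric.ball ξ (p * τ ξ + q))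
      ≤ ∑ ξ ∈ S, μ.real (Metric.ball ξ (p * τ ξ + q)) := measureReal_biUnion_finset_le _ _
    _ ≤ ∑ ξ ∈ S, (b * (2 * p) ^ δ * τ ξ ^ δ + b * 2 ^ δ * q ^ δ) := by
        refine Finset.sum_le_sum fun ξ h => ?_
        have h1 : 0 ≤ p * τ ξ := mul_nonneg hp (hτ ξ h)
        refine (hB.ball_le ξ _ (by linarith) (hr ξ h)).trans ?_
        rw [mul_assoc, mul_assoc, ← mul_add, ← Real.mul_rpow (by positivity) (hτ ξ h),
          ← Real.mul_rpow (by positivity) hq.le]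
        refine mul_le_mul_of_nonneg_left ?_ hB.b_pos.le
        have h2 : 0 ≤ (2 * p * τ ξ) ^ δ := Real.rpow_nonneg (by linarith) _
        have h3 : 0 ≤ (2 * q) ^ δ := by positivity
        rcases le_total (p * τ ξ) q with h4 | h4
        · have : (p * τ ξ + q) ^ δ ≤ (2 * q) ^ δ :=
            Real.rpow_le_rpow (by linarith) (by linarith) hδ.le
          linarith
        · have : (p * τ ξ + q) ^ δ ≤ (2 * p * τ ξ) ^ δ :=
            Real.rpow_le_rpow (by linarith) (by linarith) hδ.le
          linarith
    _ = _ := by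
        rw [Finset.sum_add_distrib, Finset.sum_const, ← Finset.mul_sum, nsmul_eq_mul]; ring

variable [BorelSpace X] [IsProbabilityMeasure μ]

lemma BallBounds.sum_rpow_le (hB : BallBounds μ δ r₀ a b) (S : Finset X) (τ : X → ℝ)
    (hτ : ∀ ξ ∈ S, 0 < τ ξ) (x : X) (r : ℝ) (hr : 0 < r) (hr₀ : r < r₀)
    (hsub : ∀ ξ ∈ S, Metric.ball ξ (τ ξ) ⊆ Metric.ball x r) (hτr : ∀ ξ ∈ S, τ ξ < r₀)
    (hdisj : ∀ ξ ∈ S, ∀ ξ' ∈ S, ξ ≠ ξ' → τ ξ + τ ξ' ≤ dist ξ ξ') :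
    a * ∑ ξ ∈ S, τ ξ ^ δ ≤ b * r ^ δ := by
  calc a * ∑ ξ ∈ S, τ ξ ^ δ = ∑ ξ ∈ S, a * τ ξ ^ δ := Finset.mul_sum ..
    _ ≤ ∑ ξ ∈ S, μ.real (Metric.ball ξ (τ ξ)) :=
        Finset.sum_le_sum fun ξ h => hB.le_ball ξ _ (hτ ξ h) (hτr ξ h)
    _ = μ.real (⋃ ξ ∈ S, Metric.ball ξ (τ ξ)) := by
        rw [measureReal_biUnion_finset]
        · intro ξ h ξ' h' hne
          exact Metric.ball_disjoint_ball (hdisj ξ h ξ' h' hne)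
        · exact fun ξ _ => Metric.isOpen_ball.measurableSet
    _ ≤ μ.real (Metric.ball x r) := measureReal_mono (iUnion₂_subset hsub)
    _ ≤ b * r ^ δ := hB.ball_le x r hr hr₀

lemma BallBounds.card_mul_le (hB : BallBounds μ δ r₀ a b) (S : Finset X) (x : X) (r d : ℝ)
    (hr : 0 < r) (hd : 0 < d) (hdr : d < r) (hr₀ : r < r₀)
    (hsub : ∀ ξ ∈ S, dist ξ x ≤ r - d)
    (hdisj : ∀ ξ ∈ S, ∀ ξ' ∈ S, ξ ≠ ξ' → 2 * d ≤ dist ξ ξ') :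
    a * (S.card * d ^ δ) ≤ b * r ^ δ := by
  have := hB.sum_rpow_le S (fun _ => d) (fun _ _ => hd) x r hr hr₀
    (fun ξ h => Metric.ball_subset_ball' (by linarith [hsub ξ h])) (fun _ _ => by linarith)
    (fun ξ h ξ' h' hne => by linarith [hdisj ξ h ξ' h' hne])
  simpa using this

end Geometry

/-! ### Greedy selection of separated balls -/

lemma exists_maximal_separated {X : Type*} [MetricSpace X] (P : Finset X) {d : ℝ} (hd : 0 < d) :
    ∃ F ⊆ P, (∀ x ∈ F, ∀ y ∈ F, x ≠ y → d ≤ dist x y) ∧ ∀ x ∈ P, ∃ y ∈ F, dist x y < d := by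
  classical
  induction P using Finset.induction_on with
  | empty => exact ⟨∅, by simp⟩
  | insert p P _ ih =>
    obtain ⟨F, hF, hsep, hcov⟩ := ih
    by_cases h : ∃ y ∈ F, dist p y < d
    · refine ⟨F, hF.trans (Finset.subset_insert _ _), hsep, fun x hx => ?_⟩
      rcases Finset.mem_insert.1 hx with rfl | hx
      · exact h
      · exact hcov x hx
    · push Not at h
      refine ⟨insert p F, Finset.insert_subset_insert _ hF, ?_, fun x hx => ?_⟩
      · intro x hx y hy hne
        rcases Finset.mem_insert.1 hx with rfl | hx' <;> rcases Finset.mem_insert.1 hy with rfl | hy'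
        · exact absurd rfl hne
        · exact h y hy'
        · rw [dist_comm]; exact h x hx'
        · exact hsep x hx' y hy' hne
      · rcases Finset.mem_insert.1 hx with rfl | hx
        · exact ⟨x, Finset.mem_insert_self _ _, by simpa⟩
        · obtain ⟨y, hy, hxy⟩ := hcov x hx
          exact ⟨y, Finset.mem_insert_of_mem hy, hxy⟩

lemma exists_scale {δ M ε : ℝ} (hδ : 0 < δ) (hε : 0 < ε) :
    ∃ K : ℝ, 5 ≤ K ∧ ∀ r : ℝ, 0 ≤ r → M * (r / K) ^ δ ≤ ε * r ^ δ := by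
  have h := ((tendsto_rpow_atTop hδ).eventually_ge_atTop (M / ε)).and (eventually_ge_atTop (5 : ℝ))
  obtain ⟨K, hK, hK5⟩ := h.exists
  refine ⟨K, hK5, fun r hr => ?_⟩
  have hKp : 0 < K ^ δ := Real.rpow_pos_of_pos (by linarith) _
  rw [Real.div_rpow hr (by linarith), mul_div_assoc', div_le_iff₀ hKp]
  have := (div_le_iff₀ hε).1 hK
  nlinarith [mul_le_mul_of_nonneg_right this (Real.rpow_nonneg hr δ)]

section Block

variable {X : Type*} [MetricSpace X] [MeasurableSpace X]
  {μ : Measure X} [IsProbabilityMeasure μ] {δ r₀ a b : ℝ}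

/-- Keep the centres whose `q`-ball reaches a point outside `D` and thin them to a maximal `K
q`-separated set. The balls of radius `2 K q` about it cover what `D` leaves over, which bounds its
cardinality below. -/
lemma BallBounds.exists_level (hB : BallBounds μ δ r₀ a b) {x : X} {r q K E : ℝ} {J D : Set X}
    (hJ : J.Finite) (hq : 0 < q) (hK : 5 ≤ K) (hKq : 2 * K * q < r₀)
    (hU : E * r ^ δ ≤ μ.real ((⋃ ξ ∈ J, Metric.ball ξ q) ∩ Metric.ball x (r / 2)))
    (hD : μ.real D ≤ E / 2 * r ^ δ) :
    ∃ F : Finset X, (∀ ξ ∈ F, ξ ∈ J ∧ ∃ y ∈ Metric.ball x (r / 2), y ∉ D ∧ dist y ξ < q) ∧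
      (∀ ξ ∈ F, ∀ ξ' ∈ F, ξ ≠ ξ' → K * q ≤ dist ξ ξ') ∧
      E / 2 * r ^ δ ≤ b * (F.card * (2 * K * q) ^ δ) := by
  classical
  have hKq0 : 0 < K * q := by positivity
  obtain ⟨F, hF, hsep, hcov⟩ := exists_maximal_separated
    (hJ.toFinset.filter fun ξ => ∃ y ∈ Metric.ball x (r / 2), y ∉ D ∧ dist y ξ < q) hKq0
  refine ⟨F, fun ξ hξ => ?_, hsep, ?_⟩
  · simpa using hF hξ
  have hsub : (⋃ ξ ∈ J, Metric.ball ξ q) ∩ Metric.ball x (r / 2) ⊆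
      D ∪ ⋃ ξ ∈ F, Metric.ball ξ (2 * K * q) := by
    rintro y ⟨hy, hyx⟩
    by_cases hyD : y ∈ D
    · exact Or.inl hyD
    right
    simp only [mem_iUnion, Metric.mem_ball, exists_prop] at hy ⊢
    obtain ⟨ξ, hξ, hyξ⟩ := hy
    obtain ⟨ζ, hζ, hd⟩ := hcov ξ (by
      simp only [Finset.mem_filter, Finite.mem_toFinset]; exact ⟨hξ, y, hyx, hyD, hyξ⟩)
    refine ⟨ζ, hζ, (dist_triangle y ξ ζ).trans_lt ?_⟩
    nlinarith
  have h1 : μ.real (⋃ ξ ∈ F, Metric.ball ξ (2 * K * q)) ≤ b * (F.card * (2 * K * q) ^ δ) := by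
    refine (measureReal_biUnion_finset_le _ _).trans ?_
    refine (Finset.sum_le_sum fun ξ _ => hB.ball_le ξ (2 * K * q) (by positivity) hKq).trans ?_
    rw [Finset.sum_const, nsmul_eq_mul]
    exact le_of_eq (by ring)
  have h2 := (hU.trans (measureReal_mono hsub)).trans (measureReal_union_le _ _)
  linarith

variable [BorelSpace X]

set_option maxHeartbeats 1000000 in
/-- From levels `J n` whose `q n`-neighbourhoods fill a fixed proportion of a ball, with a
divergence condition on `t n / q n`, select a finite family of well-separated balls
`B(ξ, τ ξ)` filling a fixed proportion `η` of the ball, avoiding the sets `D n`. -/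
lemma BallBounds.exists_block (hB : BallBounds μ δ r₀ a b) {E l : ℝ} (hE : 0 < E) (hl : 0 < l)
    (hl1 : l < 1) :
    ∃ η K : ℝ, 0 < η ∧ 0 < K ∧ ∀ (x : X) (r : ℝ), 0 < r → 3 * r < r₀ →
      ∀ (J D : ℕ → Set X) (q t : ℕ → ℝ) (τ : X → ℝ) (N : ℕ),
      (∀ n ≥ N, (J n).Finite) → (∀ n ≥ N, 0 < q n) → (∀ n ≥ N, q (n + 1) ≤ l * q n) →
      (∀ n ≥ N, K * q n ≤ r) →
      (∀ n ≥ N, E * r ^ δ ≤ μ.real ((⋃ ξ ∈ J n, Metric.ball ξ (q n)) ∩ Metric.ball x (r / 2))) →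
      (∀ n ≥ N, μ.real (D n) ≤ E / 4 * r ^ δ) →
      (∀ n ≥ N, 0 < t n) → (∀ n ≥ N, ∀ ξ ∈ J n, t n ≤ τ ξ ∧ τ ξ ≤ q n) →
      (∀ m ≥ N, ∀ n > m, ∀ ξ ∈ J m, ∀ ξ' ∈ J n, τ ξ' ≤ τ ξ) →
      ¬ Summable (fun n => (t n / q n) ^ δ) →
      ∃ S : Finset X,
        (∀ ξ ∈ S, ∃ n ≥ N, ξ ∈ J n ∧ ∃ y ∈ Metric.ball x (r / 2), y ∉ D n ∧ dist y ξ < q n) ∧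
        (∀ ξ ∈ S, ∀ ξ' ∈ S, ξ ≠ ξ' → 5 * max (τ ξ) (τ ξ') ≤ dist ξ ξ') ∧
        η * r ^ δ ≤ ∑ ξ ∈ S, τ ξ ^ δ := by
  classical
  have ha := hB.a_pos
  have hb := hB.b_pos
  have hδ := hB.exp_pos
  -- `C` here and `η` below are sized so that the two terms of `measureReal_biUnion_le`, for the
  -- balls of radius `5 τ + q` about chosen points, are each at most `E / 8 * r ^ δ`.
  set C := E / (8 * (b * 2 ^ δ)) with hC
  have hCpos : 0 < C := by positivity
  have hlδ : l ^ δ < 1 := Real.rpow_lt_one hl.le hl1 hδ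
  have hlδ0 : 0 < l ^ δ := Real.rpow_pos_of_pos hl _
  obtain ⟨K, hK5, hK⟩ := exists_scale (δ := δ) (M := b) (ε := a * (C * (1 - l ^ δ)) / 2 ^ δ) hδ
    (by have := sub_pos.2 hlδ; positivity)
  have hK0 : 0 < K := by linarith
  set η := E / (8 * (b * 10 ^ δ)) with hη
  have hηpos : 0 < η := by positivity
  refine ⟨η, 4 * K, hηpos, by positivity, ?_⟩
  intro x r hr hr₀ J D q t τ N hJ hq hql hqr hU hD ht hτ hmono hsum
  have hrδ : 0 < r ^ δ := by positivity
  set c₁ := E / 2 / (b * (2 * K) ^ δ) with hc₁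
  have hc₁pos : 0 < c₁ := by positivity
  have hqr' : ∀ n ≥ N, 20 * q n ≤ r := fun n hn => by nlinarith [hqr n hn, hq n hn]
  -- Greedy induction over levels. Each level adds a multiple of `(t n / q n) ^ δ` until the total
  -- reaches `η`, which divergence forces. The cardinality bound keeps the `q`-thickening of earlier
  -- choices affordable.
  have key : ∀ L : ℕ, ∃ S : Finset X,
      (∀ ξ ∈ S, ∃ n ≥ N, n < N + L ∧ ξ ∈ J n ∧
        ∃ y ∈ Metric.ball x (r / 2), y ∉ D n ∧ dist y ξ < q n) ∧
      (∀ ξ ∈ S, ∀ ξ' ∈ S, ξ ≠ ξ' → 5 * max (τ ξ) (τ ξ') ≤ dist ξ ξ') ∧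
      S.card * q (N + L) ^ δ ≤ C * r ^ δ ∧
      min η (c₁ * ∑ i ∈ Finset.range L, (t (N + i) / q (N + i)) ^ δ) * r ^ δ ≤
        ∑ ξ ∈ S, τ ξ ^ δ := by
    intro L
    induction L with
    | zero => exact ⟨∅, by simp, by simp, by simp; positivity, by simp [hηpos.le]⟩
    | succ L ih =>
      obtain ⟨S, hS, hsep, hcard, hsumS⟩ := ih
      set n := N + L with hn
      have hnN : n ≥ N := by omega
      have hqn := hq n hnN
      have hqn1 : 0 < q (n + 1) := hq (n + 1) (by omega)
      have hqδ : q (n + 1) ^ δ ≤ l ^ δ * q n ^ δ := by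
        rw [← Real.mul_rpow hl.le hqn.le]
        exact Real.rpow_le_rpow hqn1.le (hql n hnN) hδ.le
      have hqδ0 : 0 < q n ^ δ := by positivity
      -- Once the target is reached `S` is frozen; before that, the failure of the inequality is
      -- what makes the excluded neighbourhoods small.
      by_cases hbig : η * r ^ δ ≤ ∑ ξ ∈ S, τ ξ ^ δ
      · refine ⟨S, fun ξ hξ => ?_, hsep, ?_, ?_⟩
        · obtain ⟨m, hm, hm', h⟩ := hS ξ hξ
          exact ⟨m, hm, by omega, h⟩
        · refine le_trans ?_ hcard
          gcongr
          show q (n + 1) ≤ q n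
          nlinarith [hql n hnN]
        · refine le_trans ?_ hbig
          gcongr
          exact min_le_left _ _
      push Not at hbig
      have hSτ : ∀ ξ ∈ S, 0 < τ ξ ∧ 20 * τ ξ ≤ r := fun ξ hξ => by
        obtain ⟨m, hm, _, h, _⟩ := hS ξ hξ
        have := hτ m hm ξ h
        exact ⟨(ht m hm).trans_le this.1, by linarith [hqr' m hm]⟩
      have hD1 : μ.real (⋃ ξ ∈ S, Metric.ball ξ (5 * τ ξ + q n)) ≤ E / 4 * r ^ δ := by
        refine (hB.measureReal_biUnion_le S τ 5 (q n) (by norm_num) hqn (fun ξ h => (hSτ ξ h).1.le)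
          (fun ξ h => by linarith [(hSτ ξ h).2, hqr' n hnN])).trans ?_
        have e1 : b * (2 * 5) ^ δ * ∑ ξ ∈ S, τ ξ ^ δ ≤ b * 10 ^ δ * (η * r ^ δ) := by
          rw [show (2 * 5 : ℝ) = 10 by norm_num]
          gcongr
        have e2 : b * 2 ^ δ * (S.card * q n ^ δ) ≤ b * 2 ^ δ * (C * r ^ δ) := by gcongr
        have e3 : b * 10 ^ δ * (η * r ^ δ) = E / 8 * r ^ δ := by rw [hη]; field_simp
        have e4 : b * 2 ^ δ * (C * r ^ δ) = E / 8 * r ^ δ := by rw [hC]; field_simp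
        refine (add_le_add e1 e2).trans ?_
        rw [e3, e4]
        linarith
      obtain ⟨F, hF, hFsep, hFcard⟩ := hB.exists_level (x := x) (r := r) (E := E)
        (D := D n ∪ ⋃ ξ ∈ S, Metric.ball ξ (5 * τ ξ + q n)) (hJ n hnN) hqn hK5
        (by nlinarith [hqr n hnN]) (hU n hnN) (by
          refine (measureReal_union_le _ _).trans ?_
          linarith [hD n hnN])
      have hSF : ∀ ξ ∈ S, ∀ ξ' ∈ F, 5 * max (τ ξ) (τ ξ') ≤ dist ξ ξ' := by
        intro ξ hξ ξ' hξ'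
        obtain ⟨m, hm, hmn, hmJ, _⟩ := hS ξ hξ
        obtain ⟨hJ', y, _, hyD, hyξ⟩ := hF ξ' hξ'
        rw [max_eq_left (hmono m hm n (by omega) ξ hmJ ξ' hJ')]
        have hy : 5 * τ ξ + q n ≤ dist y ξ := by
          by_contra! h
          exact hyD (Or.inr (mem_iUnion₂.2 ⟨ξ, hξ, h⟩))
        have := dist_triangle y ξ' ξ
        rw [dist_comm ξ ξ']
        linarith
      have hdisj : Disjoint S F := by
        rw [Finset.disjoint_left]
        intro ξ h h'
        have := hSF ξ h ξ h'
        rw [max_self, dist_self] at this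
        linarith [(hSτ ξ h).1]
      refine ⟨S ∪ F, ?_, ?_, ?_, ?_⟩
      · intro ξ hξ
        rcases Finset.mem_union.1 hξ with h | h
        · obtain ⟨m, hm, hm', h⟩ := hS ξ h
          exact ⟨m, hm, by omega, h⟩
        · obtain ⟨hJ', y, hy, hyD, hyξ⟩ := hF ξ h
          exact ⟨n, hnN, by omega, hJ', y, hy, fun h => hyD (Or.inl h), hyξ⟩
      · intro ξ hξ ξ' hξ' hne
        rcases Finset.mem_union.1 hξ with h | h <;> rcases Finset.mem_union.1 hξ' with h' | h'
        · exact hsep ξ h ξ' h' hne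
        · exact hSF ξ h ξ' h'
        · rw [max_comm, dist_comm]; exact hSF ξ' h' ξ h
        · refine le_trans ?_ (hFsep ξ h ξ' h' hne)
          have := max_le (hτ n hnN ξ (hF ξ h).1).2 (hτ n hnN ξ' (hF ξ' h').1).2
          nlinarith
      · have hFc : a * (F.card * (K * q n / 2) ^ δ) ≤ b * r ^ δ := by
          refine hB.card_mul_le F x r (K * q n / 2) hr (by positivity)
            (by nlinarith [hqr n hnN]) (by linarith) (fun ξ h => ?_) (fun ξ h ξ' h' hne => ?_)
          · obtain ⟨_, y, hy, _, hyξ⟩ := hF ξ h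
            rw [Metric.mem_ball] at hy
            have := dist_triangle_left ξ x y
            linarith [hqr n hnN, hqr' n hnN]
          · linarith [hFsep ξ h ξ' h' hne]
        have hFc' : F.card * q n ^ δ ≤ C * (1 - l ^ δ) * r ^ δ := by
          have h1 := hK r hr.le
          have h2 : q n ^ δ = (2 : ℝ) ^ δ * (K * q n / 2) ^ δ / K ^ δ := by
            rw [← Real.mul_rpow (by norm_num) (by positivity), ← Real.div_rpow (by positivity) hK0.le]
            congr 1; field_simp
          rw [Real.div_rpow hr.le hK0.le] at h1
          have hKδ : 0 < K ^ δ := by positivity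
          have h2δ : (0 : ℝ) < 2 ^ δ := by positivity
          have h3 : F.card * q n ^ δ =
              a * (F.card * (K * q n / 2) ^ δ) * (2 ^ δ / (a * K ^ δ)) := by
            rw [h2]
            generalize (K * q n / 2) ^ δ = A
            generalize (F.card : ℝ) = B
            field_simp
          rw [h3]
          calc _ ≤ b * r ^ δ * (2 ^ δ / (a * K ^ δ)) := by gcongr
            _ = b * (r ^ δ / K ^ δ) * (2 ^ δ / a) := by field_simp
            _ ≤ a * (C * (1 - l ^ δ)) / 2 ^ δ * r ^ δ * (2 ^ δ / a) := by gcongr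
            _ = _ := by field_simp
        have hcu : ((S ∪ F).card : ℝ) ≤ S.card + F.card := by
          exact_mod_cast Finset.card_union_le S F
        calc ((S ∪ F).card : ℝ) * q (N + (L + 1)) ^ δ
            ≤ (S.card + F.card) * (l ^ δ * q n ^ δ) :=
              mul_le_mul hcu hqδ (by positivity) (by positivity)
          _ = l ^ δ * (S.card * q n ^ δ + F.card * q n ^ δ) := by ring
          _ ≤ l ^ δ * (C * r ^ δ + C * (1 - l ^ δ) * r ^ δ) := by gcongr
          _ ≤ C * r ^ δ := by
              have : 0 < C * r ^ δ := by positivity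
              -- With `w = l ^ δ` this is `w * (2 - w) ≤ 1`.
              nlinarith [mul_nonneg this.le (sq_nonneg (1 - l ^ δ))]
      · rw [Finset.sum_union hdisj, Finset.sum_range_succ, ← hn]
        have htn := ht n hnN
        have hF1 : c₁ * (t n / q n) ^ δ * r ^ δ ≤ ∑ ξ ∈ F, τ ξ ^ δ := by
          have h1 : F.card * t n ^ δ ≤ ∑ ξ ∈ F, τ ξ ^ δ := by
            rw [← nsmul_eq_mul, ← Finset.sum_const]
            exact Finset.sum_le_sum fun ξ h =>
              Real.rpow_le_rpow htn.le (hτ n hnN ξ (hF ξ h).1).1 hδ.le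
          refine le_trans ?_ h1
          rw [Real.mul_rpow (by positivity) hqn.le] at hFcard
          rw [Real.div_rpow htn.le hqn.le]
          have h3 : c₁ * (t n ^ δ / q n ^ δ) * r ^ δ =
              E / 2 * r ^ δ * (t n ^ δ / (q n ^ δ * (b * (2 * K) ^ δ))) := by
            rw [hc₁]; field_simp
          rw [h3]
          calc _ ≤ b * (F.card * ((2 * K) ^ δ * q n ^ δ)) *
                (t n ^ δ / (q n ^ δ * (b * (2 * K) ^ δ))) := by gcongr
            _ = _ := by field_simp
        have hle : ∑ i ∈ Finset.range L, (t (N + i) / q (N + i)) ^ δ * c₁ * r ^ δ ≤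
            ∑ ξ ∈ S, τ ξ ^ δ := by
          rw [← Finset.sum_mul, ← Finset.sum_mul, mul_comm _ c₁]
          rcases le_total η (c₁ * ∑ i ∈ Finset.range L, (t (N + i) / q (N + i)) ^ δ) with h | h
          · rw [min_eq_left h] at hsumS; linarith
          · rwa [min_eq_right h] at hsumS
        rw [← Finset.sum_mul, ← Finset.sum_mul] at hle
        calc _ ≤ (c₁ * (∑ i ∈ Finset.range L, (t (N + i) / q (N + i)) ^ δ + (t n / q n) ^ δ)) *
              r ^ δ := by gcongr; exact min_le_right _ _
          _ ≤ _ := by linarith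
  have hsum' : ¬ Summable (fun i => (t (N + i) / q (N + i)) ^ δ) := by
    simp_rw [add_comm N]
    rwa [summable_nat_add_iff (f := fun n => (t n / q n) ^ δ) N]
  rw [not_summable_iff_tendsto_nat_atTop_of_nonneg (fun i => by
    have := ht (N + i) (by omega)
    have := hq (N + i) (by omega)
    positivity)] at hsum'
  obtain ⟨L, hL⟩ := (hsum'.eventually_ge_atTop (η / c₁)).exists
  obtain ⟨S, hS, hsep, _, hS'⟩ := key L
  refine ⟨S, fun ξ hξ => ?_, hsep, ?_⟩
  · obtain ⟨m, hm, _, h⟩ := hS ξ hξ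
    exact ⟨m, hm, h⟩
  · rwa [min_eq_left (by rw [mul_comm]; exact (div_le_iff₀ hc₁pos).1 hL)] at hS'

end Block

/-! ### Tails, removal of heavy points, and pigeonhole against the cover -/

/-- All but finitely many indices contribute little, and `θ` is a lower bound for the positive `w`
on the exceptional ones. -/
lemma exists_tail_sum_le {ι : Type*} {f w : ι → ℝ} (hf : Summable f) (hw : ∀ i, 0 < w i)
    {ε : ℝ} (hε : 0 < ε) :
    ∃ θ > 0, ∀ I : Finset ι, (∀ i ∈ I, w i < θ) → ∑ i ∈ I, f i ≤ ε := by
  obtain ⟨I₀, hI₀⟩ := summable_iff_vanishing_norm.1 hf ε hε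
  have key : ∃ θ > 0, ∀ i ∈ I₀, θ ≤ w i := by
    rcases I₀.eq_empty_or_nonempty with rfl | hne
    · exact ⟨1, one_pos, by simp⟩
    · obtain ⟨j, _, hj⟩ := I₀.exists_min_image w hne
      exact ⟨w j, hw j, hj⟩
  obtain ⟨θ, hθ, hθ'⟩ := key
  refine ⟨θ, hθ, fun I hI => ?_⟩
  have hdisj : Disjoint I I₀ := by
    rw [Finset.disjoint_left]
    exact fun i hi hi' => absurd (hI i hi) (not_lt.2 (hθ' i hi'))
  exact (le_abs_self _).trans (hI₀ I hdisj).le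

lemma exists_tail_sum_le_of_subtype {X : Type*} {Q : Set X} {f w : X → ℝ}
    (hf : Summable fun ξ : Q => f ξ) (hw : ∀ ξ ∈ Q, 0 < w ξ) {ε : ℝ} (hε : 0 < ε) :
    ∃ θ > 0, ∀ P : Finset X, (∀ ζ ∈ P, ζ ∈ Q ∧ w ζ < θ) → ∑ ζ ∈ P, f ζ ≤ ε := by
  classical
  obtain ⟨θ, hθ, h⟩ := exists_tail_sum_le (w := fun ξ : Q => w ξ) hf (fun ξ => hw ξ ξ.2) hε
  refine ⟨θ, hθ, fun P hP => ?_⟩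
  rw [← Finset.sum_subtype_of_mem (p := (· ∈ Q)) f (fun ζ h => (hP ζ h).1)]
  exact h _ fun ζ hζ => (hP ζ (Finset.mem_subtype.1 hζ)).2

section Removal

variable {X : Type*} [MetricSpace X] [MeasurableSpace X] [BorelSpace X]
  {μ : Measure X} [IsProbabilityMeasure μ] {δ r₀ a b : ℝ} {Q : Set X} {R : X → ℝ} {c : ℝ}

/-- The balls `B(ζ, φ (R ζ) + 2 q)` around the points `ζ` with `A U ≤ R ζ < T` near a ball of
radius `r` have small measure, if those with `R ζ < T` have small `∑ φ (R ζ) ^ δ` and `A` is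
large. -/
lemma BallBounds.exists_removed_le (hB : BallBounds μ δ r₀ a b) (hQ : IsSystem Q R) (hc : 0 < c)
    (hsep : WellSeparated Q R c) {φ : ℝ → ℝ} (hφ : IsPosMono φ) {β : ℝ} (hβ : 0 < β) :
    ∃ A σ : ℝ, 1 ≤ A ∧ 0 < σ ∧ ∀ (x : X) (r T U q : ℝ), 0 < r → 4 * r < r₀ → 0 < q → q ≤ U →
      2 * q ≤ r → c * (A * U) ≤ r →
      (∀ P : Finset X, (∀ ζ ∈ P, ζ ∈ Q ∧ R ζ < T) → ∑ ζ ∈ P, φ (R ζ) ^ δ ≤ σ * r ^ δ) →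
      μ.real (⋃ ζ ∈ {ζ ∈ Q | A * U ≤ R ζ ∧ R ζ < T ∧ dist ζ x < 2 * r},
        Metric.ball ζ (φ (R ζ) + 2 * q)) ≤ β * r ^ δ := by
  have ha := hB.a_pos
  have hb := hB.b_pos
  have hδ := hB.exp_pos
  obtain ⟨A, hA5, hA⟩ := exists_scale (δ := δ) (M := b * 2 ^ δ * (b / a) * (12 / c) ^ δ)
    (ε := β / 2) hδ (by positivity)
  refine ⟨A, min (β / 2 / (b * 2 ^ δ)) 1, by linarith, by positivity, ?_⟩
  intro x r T U q hr hr₀ hq hqU hqr hcr hsum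
  have hrδ : 0 < r ^ δ := by positivity
  have hU : 0 < U := by linarith
  have hfin : {ζ ∈ Q | A * U ≤ R ζ ∧ R ζ < T ∧ dist ζ x < 2 * r}.Finite :=
    (hQ.finite (A * U) (by positivity)).subset fun ζ h => ⟨h.1, h.2.1⟩
  set P := hfin.toFinset with hP
  have hPm : ∀ ζ ∈ P, ζ ∈ Q ∧ A * U ≤ R ζ ∧ R ζ < T ∧ dist ζ x < 2 * r := fun ζ h =>
    (Finite.mem_toFinset hfin).1 h
  have hPφ : ∑ ζ ∈ P, φ (R ζ) ^ δ ≤ min (β / 2 / (b * 2 ^ δ)) 1 * r ^ δ :=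
    hsum P fun ζ h => ⟨(hPm ζ h).1, (hPm ζ h).2.2.1⟩
  have hφpos : ∀ ζ ∈ P, 0 < φ (R ζ) := fun ζ h => hφ.1 _ (hQ.pos ζ (hPm ζ h).1)
  have hφle : ∀ ζ ∈ P, φ (R ζ) ≤ r := fun ζ h => by
    have h1 : φ (R ζ) ^ δ ≤ r ^ δ := by
      refine (Finset.single_le_sum (f := fun ζ => φ (R ζ) ^ δ)
        (fun ζ h => (Real.rpow_pos_of_pos (hφpos ζ h) _).le) h).trans (hPφ.trans ?_)
      calc _ ≤ 1 * r ^ δ := by gcongr; exact min_le_right _ _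
        _ = _ := one_mul _
    exact (Real.rpow_le_rpow_iff (hφpos ζ h).le hr.le hδ).1 h1
  -- Weights of at least `A U` force distances of at least `c A U`, so packing bounds the number of
  -- points; since `q ≤ U`, a large `A` makes the `2 q` part negligible.
  have hcard : a * (P.card * (c * (A * U) / 2) ^ δ) ≤ b * (3 * r) ^ δ := by
    refine hB.card_mul_le P x (3 * r) (c * (A * U) / 2) (by linarith) (by positivity) (by linarith)
      (by linarith) (fun ζ h => by linarith [(hPm ζ h).2.2.2]) fun ζ h ζ' h' hne => ?_
    refine le_trans ?_ (hsep ζ (hPm ζ h).1 ζ' (hPm ζ' h').1 hne)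
    have := le_min (hPm ζ h).2.1 (hPm ζ' h').2.1
    nlinarith
  have hcard' : P.card * (2 * q) ^ δ ≤ b / a * (12 / c) ^ δ * (r / A) ^ δ := by
    have h1 : (2 * q) ^ δ ≤ (c * (A * U) / 2) ^ δ * (4 / (c * A)) ^ δ := by
      rw [← Real.mul_rpow (by positivity) (by positivity)]
      refine Real.rpow_le_rpow (by positivity) ?_ hδ.le
      have : c * (A * U) / 2 * (4 / (c * A)) = 2 * U := by field_simp; norm_num
      rw [this]; linarith
    have h2 : (12 / c) ^ δ * (r / A) ^ δ = (3 * r) ^ δ * (4 / (c * A)) ^ δ := by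
      rw [← Real.mul_rpow (by positivity) (by positivity),
        ← Real.mul_rpow (by positivity) (by positivity)]
      congr 1; field_simp; norm_num
    rw [mul_assoc, h2]
    calc P.card * (2 * q) ^ δ ≤ P.card * ((c * (A * U) / 2) ^ δ * (4 / (c * A)) ^ δ) := by gcongr
      _ = (a * (P.card * (c * (A * U) / 2) ^ δ)) / a * (4 / (c * A)) ^ δ := by
        generalize (c * (A * U) / 2) ^ δ = Z
        field_simp
      _ ≤ (b * (3 * r) ^ δ) / a * (4 / (c * A)) ^ δ := by gcongr
      _ = _ := by ring
  have hset : (⋃ ζ ∈ {ζ ∈ Q | A * U ≤ R ζ ∧ R ζ < T ∧ dist ζ x < 2 * r},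
      Metric.ball ζ (φ (R ζ) + 2 * q)) = ⋃ ζ ∈ P, Metric.ball ζ (1 * φ (R ζ) + 2 * q) := by
    simp [hP]
  rw [hset]
  refine (hB.measureReal_biUnion_le P (fun ζ => φ (R ζ)) 1 (2 * q) zero_le_one (by positivity)
    (fun ζ h => (hφpos ζ h).le) (fun ζ h => by linarith [hφle ζ h])).trans ?_
  have e1 : b * (2 * 1) ^ δ * ∑ ζ ∈ P, φ (R ζ) ^ δ ≤ β / 2 * r ^ δ := by
    rw [mul_one]
    calc _ ≤ b * 2 ^ δ * (β / 2 / (b * 2 ^ δ) * r ^ δ) := by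
          gcongr
          refine hPφ.trans ?_
          gcongr
          exact min_le_left _ _
      _ = _ := by field_simp
  have e2 : b * 2 ^ δ * (P.card * (2 * q) ^ δ) ≤ β / 2 * r ^ δ := by
    calc _ ≤ b * 2 ^ δ * (b / a * (12 / c) ^ δ * (r / A) ^ δ) := by gcongr
      _ = b * 2 ^ δ * (b / a) * (12 / c) ^ δ * (r / A) ^ δ := by ring
      _ ≤ _ := hA r hr.le
  exact (add_le_add e1 e2).trans (by linarith)

/-- A separated family of balls filling a fixed proportion of a ball contains a ball which meets
the members of a given sparse family `V` only in a small total weight. -/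
lemma BallBounds.exists_sparsely_covered (hB : BallBounds μ δ r₀ a b) {η : ℝ} (hη : 0 < η) :
    ∃ σ : ℝ, 0 < σ ∧ σ ≤ 1 ∧ ∀ (x : X) (r : ℝ), 0 < r → 4 * r < r₀ →
      ∀ (V : ℕ → Set X) (t : ℕ → ℝ) (s θ γ : ℝ), (∀ i, 0 < t i) → 0 < γ →
      (∀ i, ∀ y ∈ V i, ∀ z ∈ V i, dist y z ≤ t i) →
      (∀ I : Finset ℕ, (∀ i ∈ I, (V i ∩ Metric.closedBall x r).Nonempty) →
        ∑ i ∈ I, t i ^ δ ≤ σ * r ^ δ) →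
      (∀ I : Finset ℕ, (∀ i ∈ I, t i < θ) → ∑ i ∈ I, t i ^ s ≤ γ * (η / 4 * r ^ δ)) →
      ∀ (S : Finset X) (τ : X → ℝ), (∀ ξ ∈ S, 0 < τ ξ ∧ τ ξ ≤ θ ∧ τ ξ < r₀) →
      (∀ ξ ∈ S, Metric.ball ξ (τ ξ) ⊆ Metric.closedBall x r) →
      (∀ ξ ∈ S, ∀ ξ' ∈ S, ξ ≠ ξ' → 5 * max (τ ξ) (τ ξ') ≤ dist ξ ξ') →
      η * r ^ δ ≤ ∑ ξ ∈ S, τ ξ ^ δ →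
      ∃ ξ ∈ S, ∀ I : Finset ℕ, (∀ i ∈ I, (V i ∩ Metric.ball ξ (τ ξ)).Nonempty) →
        ∑ i ∈ I, t i ^ s ≤ γ * τ ξ ^ δ := by
  classical
  have ha := hB.a_pos
  have hb := hB.b_pos
  have hδ := hB.exp_pos
  refine ⟨min (η / 2 / (b / a * 4 ^ δ)) 1, by positivity, min_le_right _ _, ?_⟩
  intro x r hr hr₀ V t s θ γ ht hγ hV hσ htail S τ hτ hSx hsep hS
  set σ := min (η / 2 / (b / a * 4 ^ δ)) 1
  have hrδ : 0 < r ^ δ := by positivity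
  have htr : ∀ i, (V i ∩ Metric.closedBall x r).Nonempty → t i ≤ r := fun i hi => by
    have h1 := hσ {i} (by simpa using hi)
    rw [Finset.sum_singleton] at h1
    refine (Real.rpow_le_rpow_iff (ht i).le hr.le hδ).1 (h1.trans ?_)
    calc σ * r ^ δ ≤ 1 * r ^ δ := by gcongr; exact min_le_right _ _
      _ = _ := one_mul _
  -- Balls meeting a set of at least their own size. Those charged to one `V i` pack into a ball of
  -- radius `4 * t i`, so they use at most half of the total `η`.
  set Bad := S.filter fun ξ => ∃ i, (V i ∩ Metric.ball ξ (τ ξ)).Nonempty ∧ τ ξ ≤ t i with hBad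
  have hbad : ∑ ξ ∈ Bad, τ ξ ^ δ ≤ η / 2 * r ^ δ := by
    have hex : ∀ ξ : X, ∃ i, ξ ∈ Bad → (V i ∩ Metric.ball ξ (τ ξ)).Nonempty ∧ τ ξ ≤ t i := by
      intro ξ
      by_cases h : ξ ∈ Bad
      · obtain ⟨i, hi⟩ := (Finset.mem_filter.1 h).2
        exact ⟨i, fun _ => hi⟩
      · exact ⟨0, fun h' => absurd h' h⟩
    choose f hf using hex
    have hhit : ∀ i ∈ Bad.image f, (V i ∩ Metric.closedBall x r).Nonempty := by
      intro i hi
      obtain ⟨ξ, hξ, rfl⟩ := Finset.mem_image.1 hi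
      exact (hf ξ hξ).1.mono (inter_subset_inter_right _ (hSx ξ (Finset.mem_filter.1 hξ).1))
    rw [← Finset.sum_fiberwise_of_maps_to (t := Bad.image f) (g := f)
      (fun ξ h => Finset.mem_image_of_mem f h)]
    calc _ ≤ ∑ i ∈ Bad.image f, b / a * 4 ^ δ * t i ^ δ := by
          refine Finset.sum_le_sum fun i hi => ?_
          have hti := htr i (hhit i hi)
          obtain ⟨p, hp, _⟩ := hhit i hi
          have h1 := hB.sum_rpow_le (Bad.filter fun ξ => f ξ = i) τ
            (fun ξ h => (hτ ξ (Finset.mem_filter.1 (Finset.mem_filter.1 h).1).1).1) p (4 * t i)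
            (by linarith [ht i]) (by linarith) (fun ξ h => ?_)
            (fun ξ h => (hτ ξ (Finset.mem_filter.1 (Finset.mem_filter.1 h).1).1).2.2)
            (fun ξ h ξ' h' hne => ?_)
          · rw [Real.mul_rpow (by norm_num) (ht i).le] at h1
            rw [← mul_le_mul_iff_right₀ ha]
            refine h1.trans (le_of_eq ?_)
            field_simp
          · obtain ⟨hξ, rfl⟩ := Finset.mem_filter.1 h
            obtain ⟨⟨y, hy, hyξ⟩, hle⟩ := hf ξ hξ
            refine Metric.ball_subset_ball' ?_
            have h2 := hV _ y hy p hp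
            have h3 := dist_triangle_left ξ p y
            rw [Metric.mem_ball] at hyξ
            linarith [ht (f ξ)]
          · have hξ := (Finset.mem_filter.1 (Finset.mem_filter.1 h).1).1
            have hξ' := (Finset.mem_filter.1 (Finset.mem_filter.1 h').1).1
            have := hsep ξ hξ ξ' hξ' hne
            linarith [le_max_left (τ ξ) (τ ξ'), le_max_right (τ ξ) (τ ξ'), (hτ ξ hξ).1,
              (hτ ξ' hξ').1]
      _ = b / a * 4 ^ δ * ∑ i ∈ Bad.image f, t i ^ δ := (Finset.mul_sum ..).symm
      _ ≤ b / a * 4 ^ δ * (η / 2 / (b / a * 4 ^ δ) * r ^ δ) := by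
          gcongr
          refine (hσ _ hhit).trans ?_
          gcongr
          exact min_le_left _ _
      _ = _ := by field_simp
  by_contra! hcon
  choose! I hI hIlt using hcon
  have hsplit : ∑ ξ ∈ Bad, τ ξ ^ δ + ∑ ξ ∈ S \ Bad, τ ξ ^ δ = ∑ ξ ∈ S, τ ξ ^ δ := by
    rw [add_comm]
    exact Finset.sum_sdiff (Finset.filter_subset _ _)
  have hsmall : ∀ ξ ∈ S \ Bad, ∀ i ∈ I ξ, t i < τ ξ := by
    intro ξ hξ i hi
    obtain ⟨hξS, hξB⟩ := Finset.mem_sdiff.1 hξ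
    by_contra! h
    exact hξB (Finset.mem_filter.2 ⟨hξS, i, hI ξ hξS i hi, h⟩)
  -- A `V i` meeting a remaining ball is smaller than it, so the factor `5` in the separation
  -- prevents it from meeting two. If every remaining ball were overloaded, the sums would add up
  -- beyond the tail bound.
  have hdisj : Set.PairwiseDisjoint (↑(S \ Bad)) I := by
    intro ξ hξ ξ' hξ' hne
    rw [Function.onFun, Finset.disjoint_left]
    intro i hi hi'
    have h1 := hsmall ξ hξ i hi
    have hξS := (Finset.mem_sdiff.1 hξ).1
    have hξS' := (Finset.mem_sdiff.1 hξ').1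
    obtain ⟨y, hy, hyξ⟩ := hI ξ hξS i hi
    obtain ⟨z, hz, hzξ⟩ := hI ξ' hξS' i hi'
    rw [Metric.mem_ball] at hyξ hzξ
    have h2 := hV i y hy z hz
    have h3 := hsep ξ hξS ξ' hξS' hne
    have h4 := dist_triangle4 ξ y z ξ'
    rw [dist_comm ξ y] at h4
    linarith [le_max_left (τ ξ) (τ ξ'), le_max_right (τ ξ) (τ ξ'), (hτ ξ hξS).1, (hτ ξ' hξS').1]
  have h1 : ∑ i ∈ (S \ Bad).biUnion I, t i ^ s ≤ γ * (η / 4 * r ^ δ) := by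
    refine htail _ fun i hi => ?_
    obtain ⟨ξ, hξ, hi⟩ := Finset.mem_biUnion.1 hi
    exact (hsmall ξ hξ i hi).trans_le (hτ ξ (Finset.mem_sdiff.1 hξ).1).2.1
  rw [Finset.sum_biUnion hdisj] at h1
  have h2 : γ * ∑ ξ ∈ S \ Bad, τ ξ ^ δ ≤ ∑ ξ ∈ S \ Bad, ∑ i ∈ I ξ, t i ^ s := by
    rw [Finset.mul_sum]
    exact Finset.sum_le_sum fun ξ hξ => (hIlt ξ (Finset.mem_sdiff.1 hξ).1).le
  have h3 : η / 2 * r ^ δ ≤ ∑ ξ ∈ S \ Bad, τ ξ ^ δ := by linarith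
  have h4 := mul_le_mul_of_nonneg_left h3 hγ.le
  have : 0 < γ * (η * r ^ δ) := by positivity
  nlinarith

end Removal

/-! ### Thickened balls and points of `Q` isolated from intermediate weights -/

/-- The radius `min (φ y ^ (s / δ)) (ρ y)`, at most `ρ y`, of a ball whose `δ`-dimensional measure
is at most `φ y ^ s`. -/
noncomputable def thickRadius (φ ρ : ℝ → ℝ) (s δ y : ℝ) : ℝ := min (φ y ^ (s / δ)) (ρ y)

/-- The standing hypotheses on the measure, the system and the functions `ρ` and `φ`, with named
constants; the divergence condition covers all ranges of `limsup φ (u n) ^ s / ρ (u n) ^ δ`. -/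
structure Setup {X : Type*} [MetricSpace X] [MeasurableSpace X] (μ : Measure X)
    (Q : Set X) (R : X → ℝ) (u : ℕ → ℝ) (ρ φ : ℝ → ℝ)
    (δ r₀ a b c κ k l₁ l₂ s : ℝ) : Prop where
  balls : BallBounds μ δ r₀ a b
  r₀_pos : 0 < r₀
  annulus : ∀ (x : X) (r r' : ℝ), 0 < r → r < r' → r' ≤ r₀ → ∃ y, r ≤ dist y x ∧ dist y x < r'
  system : IsSystem Q R
  c_pos : 0 < c
  c_lt : c < 1
  separated : WellSeparated Q R c
  κ_pos : 0 < κ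
  ubiquitous : LocallyUbiquitous μ r₀ Q R ρ u κ
  ρ_mono : IsPosMono ρ
  φ_mono : IsPosMono φ
  u_pos : ∀ n, 0 < u n
  k_ge : 1 ≤ k
  l₁_pos : 0 < l₁
  l₁_lt : l₁ < l₂
  l₂_lt : l₂ < 1
  eventually_regular : ∀ᶠ n in atTop, u (n + 1) ≤ u n ∧ u n ≤ k * u (n + 1) ∧ ρ (u n) ≤ u n ∧
    l₁ * ρ (u n) ≤ ρ (u (n + 1)) ∧ ρ (u (n + 1)) ≤ l₂ * ρ (u n)
  u_lim : Tendsto u atTop (𝓝 0)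
  φ_lim : Tendsto (fun x => φ x / x) (𝓝[>] 0) (𝓝 0)
  summable : Summable (fun ξ : Q => (φ (R ξ) / R ξ) ^ δ)
  φρ_lim : Tendsto (fun n => φ (u n) / ρ (u n)) atTop (𝓝 0)
  s_pos : 0 < s
  s_lt : s < δ
  diverges : ¬ Summable (fun n => min 1 (φ (u n) ^ s / ρ (u n) ^ δ))

namespace Setup

variable {X : Type*} [MetricSpace X] [MeasurableSpace X] {μ : Measure X} {Q : Set X} {R : X → ℝ}
  {u : ℕ → ℝ} {ρ φ : ℝ → ℝ} {δ r₀ a b c κ k l₁ l₂ s : ℝ}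

lemma thickRadius_pos (h : Setup μ Q R u ρ φ δ r₀ a b c κ k l₁ l₂ s) {y : ℝ} (hy : 0 < y) :
    0 < thickRadius φ ρ s δ y :=
  lt_min (Real.rpow_pos_of_pos (h.φ_mono.1 y hy) _) (h.ρ_mono.1 y hy)

lemma thickRadius_le (h : Setup μ Q R u ρ φ δ r₀ a b c κ k l₁ l₂ s) {y z : ℝ} (hy : 0 < y)
    (hyz : y ≤ z) : thickRadius φ ρ s δ y ≤ thickRadius φ ρ s δ z :=
  min_le_min (Real.rpow_le_rpow (h.φ_mono.1 y hy).le (h.φ_mono.2 y z hy hyz)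
    (div_nonneg h.s_pos.le h.balls.exp_pos.le)) (h.ρ_mono.2 y z hy hyz)

lemma thickRadius_rpow (h : Setup μ Q R u ρ φ δ r₀ a b c κ k l₁ l₂ s) {y : ℝ} (hy : 0 < y) :
    thickRadius φ ρ s δ y ^ δ = min (φ y ^ s) (ρ y ^ δ) := by
  have hδ := h.balls.exp_pos
  have hφ := h.φ_mono.1 y hy
  have h1 : (φ y ^ (s / δ)) ^ δ = φ y ^ s := by
    rw [← Real.rpow_mul hφ.le, div_mul_cancel₀ _ hδ.ne']
  rw [thickRadius, ← h1]
  rcases le_total (φ y ^ (s / δ)) (ρ y) with h2 | h2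
  · rw [min_eq_left h2, min_eq_left (Real.rpow_le_rpow (by positivity) h2 hδ.le)]
  · rw [min_eq_right h2,
      min_eq_right (Real.rpow_le_rpow (h.ρ_mono.1 y hy).le h2 hδ.le)]

/-- The mismatch of indices costs only `l₁ ^ δ`, since `ρ (u n) ≤ ρ (u (n + 1)) / l₁` eventually;
what remains is the truncated series in `diverges`. -/
lemma not_summable_thickRadius (h : Setup μ Q R u ρ φ δ r₀ a b c κ k l₁ l₂ s) :
    ¬ Summable (fun n => (thickRadius φ ρ s δ (u (n + 1)) / ρ (u n)) ^ δ) := by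
  intro hsum
  refine h.diverges ((summable_nat_add_iff 1).1 ?_)
  have hl := h.l₁_pos
  have hδ := h.balls.exp_pos
  refine Summable.of_norm_bounded_eventually_nat (hsum.mul_left ((1 / l₁) ^ δ)) ?_
  filter_upwards [h.eventually_regular] with n hn
  have hu := h.u_pos (n + 1)
  have hρ := h.ρ_mono.1 _ hu
  have hρ' := h.ρ_mono.1 _ (h.u_pos n)
  have hφ := h.φ_mono.1 _ hu
  have hle : (l₁ * ρ (u n)) ^ δ ≤ ρ (u (n + 1)) ^ δ :=
    Real.rpow_le_rpow (by positivity) hn.2.2.2.1 hδ.le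
  rw [Real.norm_of_nonneg (by positivity), Real.div_rpow (h.thickRadius_pos hu).le hρ'.le,
    h.thickRadius_rpow hu, Real.div_rpow zero_le_one hl.le, Real.one_rpow]
  rw [Real.mul_rpow hl.le hρ'.le] at hle
  have hA : 0 < l₁ ^ δ := by positivity
  have hB : 0 < ρ (u n) ^ δ := by positivity
  have hC : 0 < ρ (u (n + 1)) ^ δ := by positivity
  have hD : 0 < φ (u (n + 1)) ^ s := by positivity
  rw [one_div, ← div_eq_inv_mul, div_div]
  rw [le_div_iff₀ (by positivity)]
  refine le_min ?_ ?_
  · calc _ ≤ φ (u (n + 1)) ^ s / ρ (u (n + 1)) ^ δ * ρ (u (n + 1)) ^ δ := by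
          gcongr
          · exact min_le_right _ _
          · linarith
      _ = _ := by field_simp
  · calc _ ≤ 1 * ρ (u (n + 1)) ^ δ := by
          gcongr
          · exact min_le_left _ _
          · linarith
      _ = _ := one_mul _

lemma exists_forall_lt_le_mul (h : Setup μ Q R u ρ φ δ r₀ a b c κ k l₁ l₂ s) {θ : ℝ} (hθ : 0 < θ) :
    ∃ ω > 0, ∀ y, 0 < y → y < ω → φ y ≤ θ * y := by
  have h1 := h.φ_lim.eventually_lt_const hθ
  rw [eventually_nhdsWithin_iff, Metric.eventually_nhds_iff] at h1
  obtain ⟨ω, hω, h1⟩ := h1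
  refine ⟨ω, hω, fun y hy hyω => ?_⟩
  have := h1 (y := y) (by rw [Real.dist_0_eq_abs, abs_of_pos hy]; exact hyω) hy
  exact ((div_lt_iff₀ hy).1 this).le

variable [BorelSpace X] [IsProbabilityMeasure μ]

set_option maxHeartbeats 800000 in
/-- Inside a ball, well-separated points of `Q` of small weight with large total thick measure,
which stay away from the points of `Q` of intermediate weight. -/
lemma exists_separated_family (h : Setup μ Q R u ρ φ δ r₀ a b c κ k l₁ l₂ s) :
    ∃ η σ : ℝ, 0 < η ∧ 0 < σ ∧ ∀ (x : X) (r T : ℝ), 0 < r → 4 * r < r₀ →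
      (∀ P : Finset X, (∀ ζ ∈ P, ζ ∈ Q ∧ R ζ < T) → ∑ ζ ∈ P, φ (R ζ) ^ δ ≤ σ * r ^ δ) →
      ∀ θ > 0, ∃ S : Finset X,
        (∀ ξ ∈ S, ξ ∈ Q ∧ R ξ < θ ∧ dist ξ x < 3 / 4 * r ∧
          φ (R ξ) ≤ thickRadius φ ρ s δ (R ξ) ∧ thickRadius φ ρ s δ (R ξ) < θ ∧
          ∀ ζ ∈ Q, ζ ≠ ξ → 4 * φ (R ξ) / c ≤ R ζ → R ζ < T →
            φ (R ζ) + φ (R ξ) ≤ dist ζ ξ ∨ φ (R ζ) + r ≤ dist ζ x) ∧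
        (∀ ξ ∈ S, ∀ ξ' ∈ S, ξ ≠ ξ' →
          5 * max (thickRadius φ ρ s δ (R ξ)) (thickRadius φ ρ s δ (R ξ')) ≤ dist ξ ξ') ∧
        η * r ^ δ ≤ ∑ ξ ∈ S, thickRadius φ ρ s δ (R ξ) ^ δ := by
  have hδ := h.balls.exp_pos
  have ha := h.balls.a_pos
  have hκ := h.κ_pos
  have hc := h.c_pos
  have hk := h.k_ge
  set E := κ * a * (1 / 2) ^ δ with hE
  have hEpos : 0 < E := by positivity
  obtain ⟨η, K, hη, hK, hblock⟩ := h.balls.exists_block hEpos (h.l₁_pos.trans h.l₁_lt) h.l₂_lt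
  obtain ⟨A, σ, hA, hσ, hrem⟩ := h.balls.exists_removed_le h.system hc h.separated h.φ_mono
    (β := E / 4) (by positivity)
  refine ⟨η, min σ 1, hη, by positivity, ?_⟩
  intro x r T hr hr₀ hP θ hθ
  have hrδ : 0 < r ^ δ := by positivity
  have hPσ : ∀ P : Finset X, (∀ ζ ∈ P, ζ ∈ Q ∧ R ζ < T) → ∑ ζ ∈ P, φ (R ζ) ^ δ ≤ σ * r ^ δ :=
    fun P h1 => (hP P h1).trans (by gcongr; exact min_le_left _ _)
  have hφr : ∀ ζ ∈ Q, R ζ < T → φ (R ζ) ≤ r := fun ζ hζ hζT => by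
    have h1 := hP {ζ} (by simpa using ⟨hζ, hζT⟩)
    rw [Finset.sum_singleton] at h1
    refine (Real.rpow_le_rpow_iff (h.φ_mono.1 _ (h.system.pos ζ hζ)).le hr.le hδ).1 (h1.trans ?_)
    calc _ ≤ 1 * r ^ δ := by gcongr; exact min_le_right _ _
      _ = _ := one_mul _
  obtain ⟨ω₁, hω₁, hφω⟩ := h.exists_forall_lt_le_mul (θ := c / (2 * A * k)) (by positivity)
  set ω := min (min (r / 5) θ) (min (min (r / K) (r / (c * A))) (min (ω₁ / A) 1)) with hω
  have hωpos : 0 < ω := by positivity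
  obtain ⟨NB, _, hNB⟩ := h.ubiquitous x (r / 2) (by positivity) (by linarith)
  obtain ⟨N, hN⟩ := eventually_atTop.1 (((h.eventually_regular.and
    (h.u_lim.eventually_lt_const hωpos)).and
    (h.φρ_lim.eventually_lt_const h.l₁_pos)).and (eventually_ge_atTop NB))
  have hρ : ∀ n, 0 < ρ (u n) := fun n => h.ρ_mono.1 _ (h.u_pos n)
  have hreg := fun n hn => (hN n hn).1.1.1
  have hul : ∀ n ≥ N, u n < r / 5 ∧ u n < θ ∧ u n < r / K ∧ u n < r / (c * A) ∧ u n < ω₁ / A ∧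
      u n < 1 := fun n hn => by
    have := (hN n hn).1.1.2
    simp only [hω, lt_min_iff] at this
    tauto
  have hφρ : ∀ n ≥ N, φ (u n) ≤ l₁ * ρ (u n) := fun n hn =>
    ((div_lt_iff₀ (hρ n)).1 (hN n hn).1.2).le
  have hanti : ∀ m ≥ N, ∀ n ≥ m, u n ≤ u m := by
    intro m hm n hn
    induction n, hn using Nat.le_induction with
    | base => rfl
    | succ n hn ih => exact (hreg n (by omega)).1.trans ih
  -- Shifted by one: the weights lie in `[u (n + 1), u n)`, and ubiquity for this layer uses radius
  -- `ρ (u n)`.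
  set J : ℕ → Set X := fun n => layer Q R u (n + 1) with hJ
  have hJm : ∀ n, ∀ ξ ∈ J n, ξ ∈ Q ∧ u (n + 1) ≤ R ξ ∧ R ξ < u n := fun n ξ hξ => hξ
  set D : ℕ → Set X := fun n => ⋃ ζ ∈ {ζ ∈ Q | A * u n ≤ R ζ ∧ R ζ < T ∧ dist ζ x < 2 * r},
        Metric.ball ζ (φ (R ζ) + 2 * ρ (u n)) with hD
  obtain ⟨S, hS, hsep, hsum⟩ := hblock x r hr (by linarith) J D (fun n => ρ (u n))
    (fun n => thickRadius φ ρ s δ (u (n + 1))) (fun ξ => thickRadius φ ρ s δ (R ξ)) N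
    (fun n _ => (h.system.finite (u (n + 1)) (h.u_pos _)).subset fun ξ hξ => ⟨hξ.1, hξ.2.1⟩)
    (fun n _ => hρ n) (fun n hn => (hreg n hn).2.2.2.2)
    (fun n hn => by
      have := (lt_div_iff₀ hK).1 (hul n hn).2.2.1
      nlinarith [(hreg n hn).2.2.1])
    (fun n hn => by
      have h1 := hNB (n + 1) (by have := (hN n hn).2; omega)
      have h2 := ENNReal.toReal_mono (measure_ne_top _ _) h1
      rw [ENNReal.toReal_mul, ENNReal.toReal_ofReal hκ.le] at h2
      refine le_trans ?_ h2
      have h3 := h.balls.le_ball x (r / 2) (by positivity) (by linarith)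
      rw [div_eq_mul_one_div, Real.mul_rpow hr.le (by norm_num)] at h3
      rw [← div_eq_mul_one_div] at h3
      calc E * r ^ δ = κ * (a * (r ^ δ * (1 / 2) ^ δ)) := by rw [hE]; ring
        _ ≤ _ := mul_le_mul_of_nonneg_left h3 hκ.le)
    (fun n hn => by
      refine hrem x r T (u n) (ρ (u n)) hr hr₀ (hρ n) (hreg n hn).2.2.1 ?_ ?_ hPσ
      · linarith [(hul n hn).1, (hreg n hn).2.2.1]
      · have := (lt_div_iff₀ (by positivity)).1 (hul n hn).2.2.2.1
        linarith)
    (fun n _ => h.thickRadius_pos (h.u_pos _))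
    (fun n _ ξ hξ => ⟨h.thickRadius_le (h.u_pos _) hξ.2.1, (min_le_right _ _).trans
      (h.ρ_mono.2 _ _ (h.system.pos ξ hξ.1) hξ.2.2.le)⟩)
    (fun m hm n hn ξ hξ ξ' hξ' => h.thickRadius_le (h.system.pos ξ' hξ'.1)
      ((hJm n ξ' hξ').2.2.le.trans ((hanti (m + 1) (by omega) n hn).trans hξ.2.1)))
    h.not_summable_thickRadius
  refine ⟨S, fun ξ hξ => ?_, hsep, hsum⟩
  obtain ⟨n, hn, hξJ, y, hyx, hyD, hyξ⟩ := hS ξ hξ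
  obtain ⟨hξQ, hξ1, hξ2⟩ := hJm n ξ hξJ
  obtain ⟨h1, h2, h3, h4, h5, h6⟩ := hul n hn
  obtain ⟨g1, g2, g3, g4, g5⟩ := hreg n hn
  have hRξ := h.system.pos ξ hξQ
  have hφξ := h.φ_mono.1 _ hRξ
  have hφu : φ (R ξ) ≤ φ (u n) := h.φ_mono.2 _ _ hRξ hξ2.le
  have hl1 : l₁ < 1 := h.l₁_lt.trans h.l₂_lt
  have hφq : φ (R ξ) ≤ ρ (u n) := by
    have := hφρ n hn
    nlinarith [hρ n]
  have hρξ : ρ (R ξ) ≤ ρ (u n) := h.ρ_mono.2 _ _ hRξ hξ2.le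
  rw [Metric.mem_ball] at hyx
  refine ⟨hξQ, by linarith, ?_, le_min ?_ ?_, ?_, ?_⟩
  · have := dist_triangle_left ξ x y
    linarith
  -- Lowering the exponent to `s / δ` needs `φ (R ξ) ≤ 1`, which is why `1` enters `ω`.
  · calc φ (R ξ) = φ (R ξ) ^ (1 : ℝ) := (Real.rpow_one _).symm
      _ ≤ φ (R ξ) ^ (s / δ) := Real.rpow_le_rpow_of_exponent_ge hφξ (by linarith)
          ((div_le_one hδ).2 h.s_lt.le)
  · have := h.ρ_mono.2 _ _ (h.u_pos (n + 1)) hξ1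
    linarith [hφρ n hn]
  · exact (min_le_right _ _).trans_lt (by linarith)
  · intro ζ hζ hne hζ1 hζT
    have hRζ := h.system.pos ζ hζ
    by_cases hfar : 2 * r ≤ dist ζ x
    · right
      linarith [hφr ζ hζ hζT]
    push Not at hfar
    left
    rcases le_or_gt (A * u n) (R ζ) with hbig | hsmall
    · have hy : φ (R ζ) + 2 * ρ (u n) ≤ dist y ζ := by
        by_contra! hlt
        exact hyD (mem_iUnion₂.2 ⟨ζ, ⟨hζ, hbig, hζT, hfar⟩, hlt⟩)
      have := dist_triangle_right y ζ ξ
      linarith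
    -- Weights from `4 φ (R ξ) / c` to `A u n`. Here `R ζ ≤ A k R ξ`, so `φ y ≤ c / (2 A k) * y`
    -- places both radii within the separation `c * min (R ζ) (R ξ)`.
    · refine le_trans ?_ (h.separated ζ hζ ξ hξQ hne)
      have hω1 : A * u n < ω₁ := by
        have := (lt_div_iff₀ (by positivity)).1 h5
        linarith
      have e1 := hφω (R ζ) hRζ (by linarith)
      have e2 := hφω (R ξ) hRξ ((hξ2.trans_le (le_mul_of_one_le_left (h.u_pos n).le hA)).trans hω1)
      have hAk : 1 ≤ A * k := one_le_mul_of_one_le_of_one_le hA hk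
      have hθ₁ : c / (2 * A * k) ≤ c / 2 := by
        rw [mul_assoc]
        refine div_le_div_of_nonneg_left hc.le (by norm_num) (by linarith)
      rcases le_total (R ζ) (R ξ) with hle | hle
      · rw [min_eq_left hle]
        rw [div_le_iff₀ hc] at hζ1
        have := mul_le_mul_of_nonneg_right hθ₁ hRζ.le
        linarith
      · rw [min_eq_right hle]
        have e3 : R ζ ≤ A * k * R ξ := by
          have : k * u (n + 1) ≤ k * R ξ := by gcongr
          have : A * u n ≤ A * (k * R ξ) := by gcongr; linarith
          linarith
        have e4 : c / (2 * A * k) * R ζ ≤ c / 2 * R ξ := by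
          calc _ ≤ c / (2 * A * k) * (A * k * R ξ) := by gcongr
            _ = _ := by field_simp
        have := mul_le_mul_of_nonneg_right hθ₁ hRξ.le
        linarith

end Setup

/-! ### The nested construction -/

/-- A ball on which both the sets `V i` (of size `t i`) and the balls `B(ζ, φ (R ζ))` with
`R ζ < T` have small total `δ`-dimensional size. -/
structure IsNode {X : Type*} [MetricSpace X] (Q : Set X) (R : X → ℝ) (φ : ℝ → ℝ) (δ r₀ σ : ℝ)
    (V : ℕ → Set X) (t : ℕ → ℝ) (x : X) (r T : ℝ) : Prop where
  r_pos : 0 < r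
  r_lt : 4 * r < r₀
  T_pos : 0 < T
  cover : ∀ I : Finset ℕ, (∀ i ∈ I, (V i ∩ Metric.closedBall x r).Nonempty) →
    ∑ i ∈ I, t i ^ δ ≤ σ * r ^ δ
  points : ∀ P : Finset X, (∀ ζ ∈ P, ζ ∈ Q ∧ R ζ < T) → ∑ ζ ∈ P, φ (R ζ) ^ δ ≤ σ * r ^ δ

/-- A ball `B(x', r')` inside `B(x, r)` and inside an annulus around `ξ` of outer radius
`φ (R ξ)`, which avoids all other balls `B(ζ, φ (R ζ))` with `T' ≤ R ζ < T`. -/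
structure IsChild {X : Type*} [MetricSpace X] (Q : Set X) (R : X → ℝ) (φ : ℝ → ℝ) (ε : ℝ) (ξ : X)
    (x : X) (r T : ℝ) (x' : X) (r' T' : ℝ) : Prop where
  mem : ξ ∈ Q
  r_le : r' ≤ r / 2
  T_le : T' ≤ T / 2
  lt_T : R ξ < T
  T_le_R : T' ≤ R ξ
  inside : ∀ y ∈ Metric.closedBall x' r', dist y x < r ∧ (1 - ε) * φ (R ξ) ≤ dist y ξ ∧
    dist y ξ < φ (R ξ) ∧ ∀ ζ ∈ Q, ζ ≠ ξ → T' ≤ R ζ → R ζ < T → φ (R ζ) ≤ dist y ζ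

namespace Setup

variable {X : Type*} [MetricSpace X] [MeasurableSpace X] [BorelSpace X] {μ : Measure X}
  [IsProbabilityMeasure μ] {Q : Set X} {R : X → ℝ}
  {u : ℕ → ℝ} {ρ φ : ℝ → ℝ} {δ r₀ a b c κ k l₁ l₂ s : ℝ}

set_option maxHeartbeats 800000 in
-- The constant `σ` is reproduced exactly from parent to child, whatever `ε` is, so the step can be
-- iterated with `ε` tending to `0`.
lemma exists_child (h : Setup μ Q R u ρ φ δ r₀ a b c κ k l₁ l₂ s) :
    ∃ σ : ℝ, 0 < σ ∧ ∀ (V : ℕ → Set X) (t : ℕ → ℝ), (∀ i, 0 < t i) →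
      (∀ i, ∀ y ∈ V i, ∀ z ∈ V i, dist y z ≤ t i) → Summable (fun i => t i ^ s) →
      ∀ (x : X) (r T : ℝ), IsNode Q R φ δ r₀ σ V t x r T → ∀ ε, 0 < ε → ε < 1 →
      ∃ (ξ x' : X) (r' T' : ℝ), IsNode Q R φ δ r₀ σ V t x' r' T' ∧
        IsChild Q R φ ε ξ x r T x' r' T' := by
  have hδ := h.balls.exp_pos
  have hc := h.c_pos
  have hs := h.s_pos
  obtain ⟨η, σ₁, hη, hσ₁, hfam⟩ := h.exists_separated_family
  obtain ⟨σ₂, hσ₂, hσ₂1, hspa⟩ := h.balls.exists_sparsely_covered hη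
  set σ := min σ₁ σ₂ with hσdef
  have hσ : 0 < σ := lt_min hσ₁ hσ₂
  have hσ1 : σ ≤ 1 := (min_le_right _ _).trans hσ₂1
  refine ⟨σ, hσ, ?_⟩
  intro V t ht hV hsum x r T hnode ε hε hε1
  obtain ⟨hr, hr₀, hT, hcov, hpts⟩ := hnode
  have hrδ : 0 < r ^ δ := by positivity
  -- This factor times `p ^ s` is `σ * r' ^ s` for the child radius `r' = ε * p / 8`.
  have hγ : 0 < σ * (ε / 8) ^ s := by positivity
  obtain ⟨θt, hθt, htail⟩ := exists_tail_sum_le hsum ht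
    (ε := σ * (ε / 8) ^ s * (η / 4 * r ^ δ)) (by positivity)
  obtain ⟨θQ, hθQ, htailQ⟩ := exists_tail_sum_le_of_subtype (f := fun ξ => (φ (R ξ) / R ξ) ^ δ)
    h.summable h.system.pos (ε := σ * (ε * c / 32) ^ δ) (by positivity)
  obtain ⟨ω, hω, hφω⟩ := h.exists_forall_lt_le_mul (θ := c / 4) (by positivity)
  set θ := min (min θt θQ) (min (min ω (T / 2)) (r / 8)) with hθ
  have hθpos : 0 < θ := by positivity
  have hθle : θ ≤ θt ∧ θ ≤ θQ ∧ θ ≤ ω ∧ θ ≤ T / 2 ∧ θ ≤ r / 8 := by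
    have := le_refl θ
    simp only [hθ, le_min_iff] at this
    simp only [hθ]
    tauto
  obtain ⟨hθ1, hθ2, hθ3, hθ4, hθ5⟩ := hθle
  obtain ⟨S, hS, hSsep, hSsum⟩ := hfam x r T hr hr₀
    (fun P hP => (hpts P hP).trans (by gcongr; exact min_le_left _ _)) θ hθpos
  obtain ⟨ξ, hξS, hξ⟩ := hspa x r hr hr₀ V t s θ (σ * (ε / 8) ^ s) ht hγ hV
    (fun I hI => (hcov I hI).trans (by gcongr; exact min_le_right _ _))
    (fun I hI => htail I fun i hi => (hI i hi).trans_le hθ1) S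
    (fun ξ => thickRadius φ ρ s δ (R ξ))
    (fun ξ hξ => ⟨h.thickRadius_pos (h.system.pos ξ (hS ξ hξ).1), (hS ξ hξ).2.2.2.2.1.le,
      by linarith [(hS ξ hξ).2.2.2.2.1]⟩)
    (fun ξ hξ => Metric.ball_subset_closedBall.trans (Metric.closedBall_subset_closedBall' (by
      linarith [(hS ξ hξ).2.2.2.2.1, (hS ξ hξ).2.2.1]))) hSsep hSsum
  obtain ⟨hξQ, hRθ, hξx, hφτ, hτθ, havoid⟩ := hS ξ hξS
  have hRξ := h.system.pos ξ hξQ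
  set p := φ (R ξ) with hp
  have hppos : 0 < p := h.φ_mono.1 _ hRξ
  have hpR : p ≤ c / 4 * R ξ := hφω _ hRξ (by linarith)
  have hT'R : 4 * p / c ≤ R ξ := by
    rw [div_le_iff₀ hc]; linarith
  -- A margin of `ε * p / 4` on either side leaves room for the ball of radius `ε * p / 8`.
  obtain ⟨x', hx1, hx2⟩ := h.annulus ξ ((1 - 3 * ε / 4) * p) ((1 - ε / 4) * p)
    (mul_pos (by linarith) hppos) (mul_lt_mul_of_pos_right (by linarith) hppos)
    (by nlinarith)
  have hεp : 0 < ε * p := by positivity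
  have hin : ∀ y ∈ Metric.closedBall x' (ε * p / 8),
      (1 - ε) * p ≤ dist y ξ ∧ dist y ξ < p := by
    intro y hy
    rw [Metric.mem_closedBall] at hy
    have e1 := dist_triangle y x' ξ
    have e2 := dist_triangle_left x' ξ y
    constructor <;> nlinarith
  have hεp' : ε * p < p := by nlinarith
  -- The threshold `4 * p / c` is the lowest weight controlled by `havoid`. Below it `φ ≤ (φ / R) *
  -- (4 * p / c)`, and the tail constant `(ε * c / 32) ^ δ` turns this into `σ * r' ^ δ`.
  refine ⟨ξ, x', ε * p / 8, 4 * p / c, ⟨by positivity, by linarith, by positivity, ?_, ?_⟩,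
    ⟨hξQ, by linarith, by linarith, by linarith, hT'R, ?_⟩⟩
  · intro I hI
    set r' := ε * p / 8 with hr'
    have hr'pos : 0 < r' := by positivity
    have hhit : ∀ i ∈ I, (V i ∩ Metric.ball ξ (thickRadius φ ρ s δ (R ξ))).Nonempty := by
      intro i hi
      refine (hI i hi).mono (inter_subset_inter_right _ fun y hy => ?_)
      exact (hin y hy).2.trans_le hφτ
    have hkey : ∀ I' ⊆ I, ∑ i ∈ I', t i ^ s ≤ σ * r' ^ s := by
      intro I' hI'
      refine (hξ I' fun i hi => hhit i (hI' hi)).trans ?_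
      rw [h.thickRadius_rpow hRξ]
      calc _ ≤ σ * (ε / 8) ^ s * p ^ s := by gcongr; exact min_le_left _ _
        _ = σ * r' ^ s := by
          rw [mul_assoc, ← Real.mul_rpow (by positivity) hppos.le, hr']
          congr 2; ring
    -- The `s`-sum over a single index bounds each size, so `t i ^ δ ≤ t i ^ s * r' ^ (δ - s)`
    -- returns to exponent `δ`.
    have htr : ∀ i ∈ I, t i ≤ r' := by
      intro i hi
      have h1 := hkey {i} (by simpa using hi)
      rw [Finset.sum_singleton] at h1
      refine (Real.rpow_le_rpow_iff (ht i).le hr'pos.le hs).1 (h1.trans ?_)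
      calc _ ≤ 1 * r' ^ s := by gcongr
        _ = _ := one_mul _
    calc ∑ i ∈ I, t i ^ δ ≤ ∑ i ∈ I, t i ^ s * r' ^ (δ - s) := by
          refine Finset.sum_le_sum fun i hi => ?_
          have : t i ^ δ = t i ^ s * t i ^ (δ - s) := by
            rw [← Real.rpow_add (ht i)]; congr 1; ring
          rw [this]
          refine mul_le_mul_of_nonneg_left ?_ (Real.rpow_nonneg (ht i).le _)
          exact Real.rpow_le_rpow (ht i).le (htr i hi) (by linarith [h.s_lt])
      _ = (∑ i ∈ I, t i ^ s) * r' ^ (δ - s) := (Finset.sum_mul ..).symm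
      _ ≤ σ * r' ^ s * r' ^ (δ - s) := by
          gcongr
          exact hkey I subset_rfl
      _ = σ * r' ^ δ := by
          rw [mul_assoc, ← Real.rpow_add hr'pos]; congr 2; ring
  · intro P hP
    have hT' : 0 < 4 * p / c := by positivity
    calc ∑ ζ ∈ P, φ (R ζ) ^ δ ≤ ∑ ζ ∈ P, (φ (R ζ) / R ζ) ^ δ * (4 * p / c) ^ δ := by
          refine Finset.sum_le_sum fun ζ hζ => ?_
          obtain ⟨hζQ, hζT⟩ := hP ζ hζ
          have hRζ := h.system.pos ζ hζQ
          have hφζ := h.φ_mono.1 _ hRζ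
          rw [← Real.mul_rpow (by positivity) hT'.le]
          refine Real.rpow_le_rpow hφζ.le ?_ hδ.le
          calc φ (R ζ) = φ (R ζ) / R ζ * R ζ := by field_simp
            _ ≤ _ := by gcongr
      _ = (∑ ζ ∈ P, (φ (R ζ) / R ζ) ^ δ) * (4 * p / c) ^ δ := (Finset.sum_mul ..).symm
      _ ≤ σ * (ε * c / 32) ^ δ * (4 * p / c) ^ δ := by
          gcongr
          exact htailQ P fun ζ hζ => ⟨(hP ζ hζ).1, by linarith [(hP ζ hζ).2]⟩
      _ = σ * (ε * p / 8) ^ δ := by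
          rw [mul_assoc, ← Real.mul_rpow (by positivity) hT'.le]
          congr 2; field_simp; norm_num
  · intro y hy
    obtain ⟨hy1, hy2⟩ := hin y hy
    have hyx : dist y x < r := by
      have := dist_triangle y ξ x
      linarith
    refine ⟨hyx, hy1, hy2, fun ζ hζ hne hζ1 hζ2 => ?_⟩
    rcases havoid ζ hζ hne hζ1 hζ2 with h1 | h1
    · have := dist_triangle_left ζ ξ y
      linarith
    · have := dist_triangle_left ζ x y
      linarith

variable [CompactSpace X]

lemma exists_mem_exactSet (h : Setup μ Q R u ρ φ δ r₀ a b c κ k l₁ l₂ s) :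
    ∃ σ : ℝ, 0 < σ ∧ ∀ (V : ℕ → Set X) (t : ℕ → ℝ), (∀ i, 0 < t i) →
      (∀ i, ∀ y ∈ V i, ∀ z ∈ V i, dist y z ≤ t i) → Summable (fun i => t i ^ s) →
      ∀ (x : X) (r T : ℝ), IsNode Q R φ δ r₀ σ V t x r T →
      ∃ z ∈ exactSet Q R φ, ∀ i, z ∉ V i := by
  have hδ := h.balls.exp_pos
  obtain ⟨σ, hσ, hchild⟩ := h.exists_child
  refine ⟨σ, hσ, fun V t ht hV hsum x₀ r' T' hnode => ?_⟩
  have hstep : ∀ (j : ℕ) (v : {v : X × ℝ × ℝ // IsNode Q R φ δ r₀ σ V t v.1 v.2.1 v.2.2}),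
      ∃ (w : {v : X × ℝ × ℝ // IsNode Q R φ δ r₀ σ V t v.1 v.2.1 v.2.2}) (ξ : X),
        IsChild Q R φ (1 / ((j : ℝ) + 2)) ξ v.1.1 v.1.2.1 v.1.2.2 w.1.1 w.1.2.1 w.1.2.2 := by
    intro j v
    obtain ⟨ξ, x', r', T', h1, h2⟩ := hchild V t ht hV hsum _ _ _ v.2 (1 / ((j : ℝ) + 2))
      (by positivity) (by rw [div_lt_one (by positivity)]; linarith [(Nat.cast_nonneg j : (0:ℝ) ≤ j)])
    exact ⟨⟨(x', r', T'), h1⟩, ξ, h2⟩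
  choose next pt hnext using hstep
  let v : ℕ → {v : X × ℝ × ℝ // IsNode Q R φ δ r₀ σ V t v.1 v.2.1 v.2.2} :=
    fun n => Nat.rec ⟨(x₀, r', T'), hnode⟩ (fun j w => next j w) n
  set x : ℕ → X := fun n => (v n).1.1 with hx
  set r : ℕ → ℝ := fun n => (v n).1.2.1 with hr
  set T : ℕ → ℝ := fun n => (v n).1.2.2 with hT
  set ξ : ℕ → X := fun n => pt n (v n) with hξ
  have hn : ∀ n, IsNode Q R φ δ r₀ σ V t (x n) (r n) (T n) := fun n => (v n).2
  have hc : ∀ n : ℕ, IsChild Q R φ (1 / ((n : ℝ) + 2)) (ξ n) (x n) (r n) (T n)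
      (x (n + 1)) (r (n + 1)) (T (n + 1)) := fun n => hnext n (v n)
  clear_value x r T ξ
  have hlim : ∀ f : ℕ → ℝ, (∀ n, 0 < f n) → (∀ n, f (n + 1) ≤ f n / 2) →
      Tendsto f atTop (𝓝 0) := by
    intro f hf hf'
    have hle : ∀ n, f n ≤ f 0 * (1 / 2) ^ n := by
      intro n
      induction n with
      | zero => simp
      | succ n ih => rw [pow_succ]; linarith [hf' n]
    have h0 : Tendsto (fun n => f 0 * (1 / 2 : ℝ) ^ n) atTop (𝓝 0) := by
      simpa using (tendsto_pow_atTop_nhds_zero_of_lt_one (r := (1 / 2 : ℝ)) (by norm_num)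
        (by norm_num)).const_mul (f 0)
    exact squeeze_zero (fun n => (hf n).le) hle h0
  have hrlim := hlim r (fun n => (hn n).r_pos) fun n => (hc n).r_le
  have hTlim := hlim T (fun n => (hn n).T_pos) fun n => (hc n).T_le
  have hTanti : Antitone T := antitone_nat_of_succ_le fun n => by
    linarith [(hc n).T_le, (hn n).T_pos]
  obtain ⟨z, hz⟩ := IsCompact.nonempty_iInter_of_sequence_nonempty_isCompact_isClosed
    (fun n => Metric.closedBall (x n) (r n))
    (fun n y hy => ((hc n).inside y hy).1.le)
    (fun n => Metric.nonempty_closedBall.2 (hn n).r_pos.le)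
    Metric.isClosed_closedBall.isCompact (fun n => Metric.isClosed_closedBall)
  rw [mem_iInter] at hz
  have hzin := fun n : ℕ => ((hc n).inside z (hz (n + 1))).2
  refine ⟨z, ⟨?_, ?_⟩, ?_⟩
  -- The weight ranges `[T (n + 1), T n)` are disjoint, so the centres are distinct.
  · have hanti : StrictAnti fun n => R (ξ n) := strictAnti_nat_of_succ_lt fun n =>
      (hc (n + 1)).lt_T.trans_le (hc n).T_le_R
    have hinj : Function.Injective ξ := fun m n hmn => hanti.injective (congrArg R hmn)
    refine (infinite_range_of_injective hinj).mono ?_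
    rintro _ ⟨n, rfl⟩
    exact ⟨(hc n).mem, (hzin n).2.1⟩
  · simp only [mem_iUnion, not_exists]
    rintro ε ⟨hε, _⟩ hW
    obtain ⟨m, hm⟩ := exists_nat_gt (1 / ε)
    refine hW ((h.system.finite (T m) (hn m).T_pos).subset ?_)
    rintro ζ ⟨hζ, hd⟩
    replace hd : dist z ζ < (1 - ε) * φ (R ζ) := hd
    refine ⟨hζ, ?_⟩
    by_contra! hlt
    have hRζ := h.system.pos ζ hζ
    have hφζ := h.φ_mono.1 _ hRζ
    have hex : ∃ n, T n ≤ R ζ := ((hTlim.eventually_lt_const hRζ).exists).imp fun n hn => hn.le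
    classical
    -- Locates the step `n` with `T (n + 1) ≤ R ζ < T n`. Either `ζ` is its centre and the annulus
    -- excludes `(1 - ε) * φ`, or `ζ` was avoided at that step.
    obtain ⟨n, hn'⟩ : ∃ n, Nat.find hex = n + 1 := by
      refine Nat.exists_eq_succ_of_ne_zero fun h0 => ?_
      have := Nat.find_spec hex
      rw [h0] at this
      linarith [hTanti (Nat.zero_le m)]
    have h1 : T (n + 1) ≤ R ζ := hn' ▸ Nat.find_spec hex
    have h2 : R ζ < T n := not_le.1 (Nat.find_min hex (by omega))
    have hmn : m ≤ n := by
      by_contra! hnm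
      have : T m ≤ T (n + 1) := hTanti hnm
      linarith
    by_cases hζξ : ζ = ξ n
    · subst hζξ
      have h3 := (hzin n).1
      have h4 : 1 / ((n : ℝ) + 2) < ε := by
        rw [div_lt_iff₀ (by positivity)]
        have h5 : (m : ℝ) ≤ n := by exact_mod_cast hmn
        have h6 := (div_lt_iff₀ hε).1 hm
        nlinarith
      nlinarith
    · have h3 := (hzin n).2.2 ζ hζ hζξ h1 h2
      have : 0 < ε * φ (R ζ) := by positivity
      linarith
  · intro i hi
    have h1 : ∀ n, t i ^ δ ≤ σ * r n ^ δ := fun n => by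
      have := (hn n).cover {i} (by simpa using ⟨z, hi, hz n⟩)
      simpa using this
    have h2 : Tendsto (fun n => σ * r n ^ δ) atTop (𝓝 (σ * 0 ^ δ)) :=
      (hrlim.rpow_const (Or.inr hδ.le)).const_mul σ
    rw [Real.zero_rpow hδ.ne', mul_zero] at h2
    exact absurd (ge_of_tendsto' h2 h1) (not_le.2 (Real.rpow_pos_of_pos (ht i) _))

end Setup

/-! ### From finite Hausdorff measure to a contradiction -/

/-- A set of finite `s`-dimensional Hausdorff measure has covers by sets of positive sizes `t i`
which are uniformly small, with `∑ t i ^ s` bounded independently of the smallness. -/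
lemma exists_cover_of_hausdorffMeasure_lt_top {X : Type*} [MetricSpace X] [MeasurableSpace X]
    [BorelSpace X] {s : ℝ} (hs : 0 < s) {E : Set X} (hE : Measure.hausdorffMeasure s E < ⊤) :
    ∃ B : ℝ, 0 < B ∧ ∀ θ : ℝ, 0 < θ → θ ≤ 1 → ∃ (V : ℕ → Set X) (t : ℕ → ℝ),
      E ⊆ ⋃ i, V i ∧ (∀ i, 0 < t i ∧ t i ≤ θ) ∧
      (∀ i, ∀ y ∈ V i, ∀ z ∈ V i, dist y z ≤ t i) ∧ Summable (fun i => t i ^ s) ∧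
      ∑' i, t i ^ s ≤ B := by
  set M := Measure.hausdorffMeasure s E + 1 with hM
  have hMtop : M < ⊤ := ENNReal.add_lt_top.2 ⟨hE, ENNReal.one_lt_top⟩
  have hgeo : Summable fun i : ℕ => ((1 / 2 : ℝ) ^ s) ^ i :=
    summable_geometric_of_lt_one (by positivity)
      (Real.rpow_lt_one (by norm_num) (by norm_num) hs)
  have hgeo0 : 0 ≤ ∑' i : ℕ, ((1 / 2 : ℝ) ^ s) ^ i := tsum_nonneg fun i => by positivity
  refine ⟨M.toReal + ∑' i : ℕ, ((1 / 2 : ℝ) ^ s) ^ i + 1, by positivity, fun θ hθ hθ1 => ?_⟩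
  have hlt : (⨅ (t : ℕ → Set X) (_ : E ⊆ ⋃ n, t n)
      (_ : ∀ n, Metric.ediam (t n) ≤ ENNReal.ofReal θ),
      ∑' n, ⨆ _ : (t n).Nonempty, Metric.ediam (t n) ^ s) < M := by
    have h1 : Measure.hausdorffMeasure s E < M := ENNReal.lt_add_right hE.ne one_ne_zero
    rw [Measure.hausdorffMeasure_apply] at h1
    exact (le_iSup₂ (f := fun (r : ℝ≥0∞) (_ : 0 < r) => ⨅ (t : ℕ → Set X) (_ : E ⊆ ⋃ n, t n)
      (_ : ∀ n, Metric.ediam (t n) ≤ r), ∑' n, ⨆ _ : (t n).Nonempty, Metric.ediam (t n) ^ s)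
      (ENNReal.ofReal θ) (ENNReal.ofReal_pos.2 hθ)).trans_lt h1
  simp only [iInf_lt_iff] at hlt
  obtain ⟨V, hEV, hVθ, hVM⟩ := hlt
  set f : ℕ → ℝ≥0∞ := fun n => ⨆ _ : (V n).Nonempty, Metric.ediam (V n) ^ s with hf
  have hsumf : Summable fun n => (f n).toReal := ENNReal.summable_toReal (hVM.trans hMtop).ne
  have hftop : ∀ n, f n ≠ ⊤ := ENNReal.ne_top_of_tsum_ne_top (hVM.trans hMtop).ne
  have htsumf : ∑' n, (f n).toReal ≤ M.toReal := by
    rw [← ENNReal.tsum_toReal_eq hftop]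
    exact ENNReal.toReal_mono hMtop.ne hVM.le
  have hdtop : ∀ n, Metric.ediam (V n) ≠ ⊤ := fun n =>
    ((hVθ n).trans_lt ENNReal.ofReal_lt_top).ne
  set d : ℕ → ℝ := fun n => (Metric.ediam (V n)).toReal with hd
  have hd0 : ∀ n, 0 ≤ d n := fun n => ENNReal.toReal_nonneg
  have hdf : ∀ n, d n ^ s ≤ (f n).toReal := by
    intro n
    rcases (V n).eq_empty_or_nonempty with h | h
    · simp only [hd, h, Metric.ediam_empty, ENNReal.toReal_zero]
      rw [Real.zero_rpow hs.ne']
      exact ENNReal.toReal_nonneg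
    · simp only [hf, h, iSup_pos, hd]
      rw [ENNReal.toReal_rpow]
  -- Sizes must be positive even for sets of zero diameter; the padding adds at most a geometric
  -- series, independent of `θ ≤ 1`.
  set t : ℕ → ℝ := fun n => max (d n) (θ * (1 / 2) ^ n) with ht
  have hts : ∀ n, t n ^ s ≤ (f n).toReal + ((1 / 2 : ℝ) ^ s) ^ n := by
    intro n
    have h0 : 0 ≤ (f n).toReal := ENNReal.toReal_nonneg
    have h1 : (θ * (1 / 2) ^ n) ^ s ≤ ((1 / 2 : ℝ) ^ s) ^ n := by
      rw [← Real.rpow_natCast ((1 / 2 : ℝ) ^ s), ← Real.rpow_mul (by norm_num), mul_comm s,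
        Real.rpow_mul (by norm_num), Real.rpow_natCast]
      refine Real.rpow_le_rpow (by positivity) ?_ hs.le
      exact mul_le_of_le_one_left (by positivity) hθ1
    have h2 : (0 : ℝ) ≤ ((1 / 2 : ℝ) ^ s) ^ n := by positivity
    rcases max_choice (d n) (θ * (1 / 2) ^ n) with h | h <;> simp only [ht, h]
    · linarith [hdf n]
    · linarith
  have htpos : ∀ n, 0 < t n := fun n => lt_max_of_lt_right (by positivity)
  have hsum : Summable fun n => t n ^ s :=
    (hsumf.add hgeo).of_nonneg_of_le (fun n => Real.rpow_nonneg (htpos n).le _) hts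
  refine ⟨V, t, hEV, fun n => ⟨htpos n, max_le ?_ ?_⟩, fun n y hy z hz => ?_, hsum, ?_⟩
  · exact ENNReal.toReal_le_of_le_ofReal hθ.le (hVθ n)
  · exact mul_le_of_le_one_right hθ.le (pow_le_one₀ (by norm_num) (by norm_num))
  · refine le_max_of_le_left ?_
    have := ENNReal.toReal_mono (hdtop n) (Metric.edist_le_ediam_of_mem hy hz)
    rwa [← dist_edist] at this
  · refine (hsum.tsum_le_tsum hts (hsumf.add hgeo)).trans ?_
    rw [hsumf.tsum_add hgeo]
    linarith

theorem Setup.hausdorffMeasure_exactSet {X : Type*} [MetricSpace X] [CompactSpace X]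
    [MeasurableSpace X] [BorelSpace X] {μ : Measure X} [IsProbabilityMeasure μ] {Q : Set X}
    {R : X → ℝ} {u : ℕ → ℝ} {ρ φ : ℝ → ℝ} {δ r₀ a b c κ k l₁ l₂ s : ℝ}
    (h : Setup μ Q R u ρ φ δ r₀ a b c κ k l₁ l₂ s) :
    Measure.hausdorffMeasure s (exactSet Q R φ) = ⊤ := by
  by_contra hne
  have hδ := h.balls.exp_pos
  have hs := h.s_pos
  have hr₀ := h.r₀_pos
  have hsδ : 0 < δ - s := sub_pos.2 h.s_lt
  obtain ⟨σ, hσ, hmem⟩ := h.exists_mem_exactSet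
  obtain ⟨B, hB, hcov⟩ := exists_cover_of_hausdorffMeasure_lt_top hs (lt_top_iff_ne_top.2 hne)
  obtain ⟨x⟩ : Nonempty X := nonempty_of_isProbabilityMeasure μ
  set r := r₀ / 5 with hr
  have hrpos : 0 < r := by positivity
  have hrδ : 0 < r ^ δ := by positivity
  obtain ⟨θQ, hθQ, htailQ⟩ := exists_tail_sum_le_of_subtype (f := fun ξ => (φ (R ξ) / R ξ) ^ δ)
    h.summable h.system.pos (ε := σ * r ^ δ) (by positivity)
  -- Solves `B * θ ^ (δ - s) ≤ σ * r ^ δ`; this is possible because `B` was fixed before `θ`.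
  set θ := min ((σ * r ^ δ / B) ^ (1 / (δ - s))) 1 with hθ
  have hθpos : 0 < θ := by positivity
  have hθB : B * θ ^ (δ - s) ≤ σ * r ^ δ := by
    have h1 : θ ^ (δ - s) ≤ ((σ * r ^ δ / B) ^ (1 / (δ - s))) ^ (δ - s) :=
      Real.rpow_le_rpow hθpos.le (min_le_left _ _) hsδ.le
    rw [← Real.rpow_mul (by positivity), one_div_mul_cancel hsδ.ne', Real.rpow_one,
      le_div_iff₀ hB] at h1
    linarith
  obtain ⟨V, t, hEV, ht, hV, hsum, hsumB⟩ := hcov θ hθpos (min_le_right _ _)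
  -- The cap `1` on the weights gives `φ ≤ φ / R`, so the convergent series applies directly.
  have hnode : IsNode Q R φ δ r₀ σ V t x r (min θQ 1) := by
    refine ⟨hrpos, by linarith, by positivity, fun I _ => ?_, fun P hP => ?_⟩
    · calc ∑ i ∈ I, t i ^ δ ≤ ∑ i ∈ I, t i ^ s * θ ^ (δ - s) := by
            refine Finset.sum_le_sum fun i _ => ?_
            have : t i ^ δ = t i ^ s * t i ^ (δ - s) := by
              rw [← Real.rpow_add (ht i).1]; congr 1; ring
            rw [this]
            exact mul_le_mul_of_nonneg_left (Real.rpow_le_rpow (ht i).1.le (ht i).2 hsδ.le)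
              (Real.rpow_nonneg (ht i).1.le _)
        _ = (∑ i ∈ I, t i ^ s) * θ ^ (δ - s) := (Finset.sum_mul ..).symm
        _ ≤ B * θ ^ (δ - s) := by
            gcongr
            exact (hsum.sum_le_tsum I fun i _ => Real.rpow_nonneg (ht i).1.le _).trans hsumB
        _ ≤ _ := hθB
    · refine le_trans (Finset.sum_le_sum fun ζ hζ => ?_)
        (htailQ P fun ζ hζ => ⟨(hP ζ hζ).1, (hP ζ hζ).2.trans_le (min_le_left _ _)⟩)
      have hRζ := h.system.pos ζ (hP ζ hζ).1
      have hφζ := h.φ_mono.1 _ hRζ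
      refine Real.rpow_le_rpow hφζ.le ?_ hδ.le
      exact le_div_self hφζ.le hRζ ((hP ζ hζ).2.trans_le (min_le_right _ _)).le
  obtain ⟨z, hz, hzV⟩ := hmem V t (fun i => (ht i).1) hV hsum x r (min θQ 1) hnode
  obtain ⟨i, hi⟩ := mem_iUnion.1 (hEV hz)
  exact hzV i hi

/-! ### Reduction of the hypotheses to `Setup` -/

/-- The construction needs only that annuli are nonempty, which their positive measure gives. -/
lemma IsRegularMeasure.exists_bounds {X : Type*} [MetricSpace X] [MeasurableSpace X]
    {μ : Measure X} [IsProbabilityMeasure μ] {δ r₀ : ℝ} (hμ : IsRegularMeasure μ δ r₀) :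
    0 < r₀ ∧ (∃ a b, BallBounds μ δ r₀ a b) ∧
      ∀ (x : X) (r r' : ℝ), 0 < r → r < r' → r' ≤ r₀ → ∃ y, r ≤ dist y x ∧ dist y x < r' := by
  obtain ⟨hδ, hr₀, a, b, ha, _, hb, hab⟩ := hμ
  refine ⟨hr₀, ⟨a, b, ha, by linarith, hδ, fun x r hr hr' => ?_, fun x r hr hr' => ?_⟩,
    fun x r r' hr hr' hr₀' => ?_⟩
  · have h1 := ENNReal.toReal_mono (measure_ne_top _ _) (hab x r r₀ hr hr' le_rfl).1
    rwa [ENNReal.toReal_ofReal (by positivity)] at h1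
  · exact ENNReal.toReal_le_of_le_ofReal (by positivity) (hab x r r₀ hr hr' le_rfl).2.1
  · have h1 := (hab x r r' hr hr' hr₀').2.2
    have h2 : 0 < a * (r' - r) ^ δ := mul_pos ha (Real.rpow_pos_of_pos (by linarith) _)
    obtain ⟨y, hy⟩ := nonempty_of_measure_ne_zero ((ENNReal.ofReal_pos.2 h2).trans_le h1).ne'
    exact ⟨y, not_lt.1 hy.2, hy.1⟩

/-- `ρ (u n)` decays geometrically, whereas `u n ≥ y > 0` would keep it at least `ρ y > 0`. -/
lemma tendsto_zero_of_isSeqRegular {ρ : ℝ → ℝ} {u : ℕ → ℝ} (hρ : IsPosMono ρ)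
    (hu : ∀ n, 0 < u n) {l : ℝ} (hl0 : 0 ≤ l) (hl : l < 1) {N : ℕ}
    (h : ∀ n ≥ N, ρ (u (n + 1)) ≤ l * ρ (u n)) : Tendsto u atTop (𝓝 0) := by
  have hle : ∀ n, ρ (u (n + N)) ≤ ρ (u N) * l ^ n := by
    intro n
    induction n with
    | zero => simp
    | succ n ih =>
      have h1 := h (n + N) (by omega)
      rw [show n + 1 + N = n + N + 1 by ring, pow_succ]
      nlinarith
  have hlim : Tendsto (fun n => ρ (u N) * l ^ n) atTop (𝓝 0) := by
    simpa using (tendsto_pow_atTop_nhds_zero_of_lt_one hl0 hl).const_mul (ρ (u N))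
  have hρlim : Tendsto (fun n => ρ (u (n + N))) atTop (𝓝 0) :=
    squeeze_zero (fun n => (hρ.1 _ (hu _)).le) hle hlim
  refine (tendsto_add_atTop_iff_nat N).1 (tendsto_order.2 ⟨fun y hy =>
    Eventually.of_forall fun n => hy.trans (hu _), fun y hy => ?_⟩)
  filter_upwards [hρlim.eventually_lt_const (hρ.1 y hy)] with n hn
  by_contra! hlt
  exact absurd (hρ.2 y _ hy hlt) (not_le.2 hn)

lemma exists_eventually_le_mul {u : ℕ → ℝ} (hu : ∀ n, 0 < u n)
    (h : limsup (fun n => ENNReal.ofReal (u n / u (n + 1))) atTop < ⊤) :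
    ∃ k : ℝ, 1 ≤ k ∧ ∀ᶠ n in atTop, u n ≤ k * u (n + 1) := by
  obtain ⟨K, hK, hKtop⟩ := exists_between h
  refine ⟨max 1 K.toReal, le_max_left _ _, ?_⟩
  filter_upwards [eventually_lt_of_limsup_lt hK] with n hn
  have h1 : u n / u (n + 1) ≤ K.toReal :=
    (ENNReal.ofReal_le_iff_le_toReal hKtop.ne).1 hn.le
  exact (div_le_iff₀ (hu _)).1 (h1.trans (le_max_right _ _))

/-- Truncation at `1` treats both cases of the theorem, including `G = ∞`, at once: if the truncated
series converged, the terms would eventually be untruncated, so `g` would be summable and tend to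
`0`. -/
lemma not_summable_min_one {g : ℕ → ℝ}
    (h : limsup (fun n => ENNReal.ofReal (g n)) atTop ≠ 0 ∨
      ∑' n, ENNReal.ofReal (g (n + 1)) = ⊤) : ¬ Summable fun n => min 1 (g n) := by
  intro hsum
  have heq : ∀ᶠ n in atTop, min 1 (g n) = g n := by
    filter_upwards [hsum.tendsto_atTop_zero.eventually_lt_const one_pos] with n hn
    refine min_eq_right ?_
    by_contra! hlt
    rw [min_eq_left hlt.le] at hn
    exact lt_irrefl _ hn
  have hg' : Summable g := (summable_congr_atTop heq).1 hsum
  rcases h with h | h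
  · have h1 := ENNReal.tendsto_ofReal hg'.tendsto_atTop_zero
    rw [ENNReal.ofReal_zero] at h1
    exact h h1.limsup_eq
  · exact ((summable_nat_add_iff 1).2 hg').tsum_ofReal_ne_top h

end ExactApprox

theorem theorem1p1 {X : Type*} [MetricSpace X] [CompactSpace X] [MeasurableSpace X]
    [BorelSpace X] (μ : Measure X) [IsProbabilityMeasure μ] (δ r₀ : ℝ)
    (hμ : ExactApprox.IsRegularMeasure μ δ r₀)
    (u : ℕ → ℝ) (hu : ∀ n, 0 < u n)
    (hu' : limsup (fun n => ENNReal.ofReal (u n / u (n + 1))) atTop < ⊤)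
    (Q : Set X) (R : X → ℝ) (hQ : ExactApprox.IsSystem Q R)
    (ρ : ℝ → ℝ) (hQρ : ExactApprox.WellDistributed μ r₀ Q R ρ u)
    (hρ : ExactApprox.IsSeqRegular ρ u)
    (φ : ℝ → ℝ) (hφ : ExactApprox.IsPosMono φ)
    (hφ0 : Tendsto (fun x => φ x / x) (𝓝[>] 0) (𝓝 0))
    (hφQ : Summable (fun ξ : Q => (φ (R ξ) / R ξ) ^ δ))
    (hφρ : Tendsto (fun n => φ (u n) / ρ (u n)) atTop (𝓝 0))
    (s : ℝ) (hs0 : 0 < s) (hsδ : s < δ) :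
    (ExactApprox.GConst φ ρ s δ u = 0 →
      ∑' n : ℕ, ExactApprox.gFun φ ρ s δ (u (n + 1)) = ⊤ →
      Measure.hausdorffMeasure s (ExactApprox.exactSet Q R φ) = ⊤) ∧
    (0 < ExactApprox.GConst φ ρ s δ u →
      Measure.hausdorffMeasure s (ExactApprox.exactSet Q R φ) = ⊤) := by
  obtain ⟨hr₀, ⟨a, b, hab⟩, hann⟩ := hμ.exists_bounds
  obtain ⟨hρm, -, c, κ, hc, hc1, hκ, -, hsep, hub⟩ := hQρ
  obtain ⟨n₀, l₁, l₂, hl₁, hl₁₂, hl₂, hreg⟩ := hρ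
  obtain ⟨k, hk, hku⟩ := ExactApprox.exists_eventually_le_mul hu hu'
  have key : limsup (fun n => ENNReal.ofReal (φ (u n) ^ s / ρ (u n) ^ δ)) atTop ≠ 0 ∨
      ∑' n, ENNReal.ofReal (φ (u (n + 1)) ^ s / ρ (u (n + 1)) ^ δ) = ⊤ →
      Measure.hausdorffMeasure s (ExactApprox.exactSet Q R φ) = ⊤ := by
    intro hdiv
    refine ExactApprox.Setup.hausdorffMeasure_exactSet (μ := μ) (u := u) (ρ := ρ) (δ := δ)
      (r₀ := r₀) (a := a) (b := b) (c := c) (κ := κ) (k := k) (l₁ := l₁) (l₂ := l₂)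
      ⟨hab, hr₀, hann, hQ, hc, hc1, hsep, hκ, hub, hρm, hφ, hu, hk, hl₁, hl₁₂, hl₂, ?_,
        ExactApprox.tendsto_zero_of_isSeqRegular hρm hu (hl₁.trans hl₁₂).le hl₂
          fun n hn => (hreg n hn).2.1,
        hφ0, hφQ, hφρ, hs0, hsδ, ExactApprox.not_summable_min_one hdiv⟩
    filter_upwards [hku, eventually_ge_atTop n₀] with n hn hn₀
    obtain ⟨h1, h2, h3⟩ := hreg n hn₀
    refine ⟨?_, hn, h3 _ (hu n) le_rfl, h1, h2⟩
    -- A step up in `u` would make `ρ` non-decreasing there, against its contraction by `l₂ < 1`.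
    by_contra! hlt
    have h4 := hρm.2 _ _ (hu n) hlt.le
    have h5 := hρm.1 _ (hu n)
    nlinarith
  exact ⟨fun _ h => key (Or.inr h), fun h => key (Or.inl h.ne')⟩
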